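/- **Setting.** Let $M=(X,d)$ be a geodesic metric space with origin $o$ (so that a server can move in it at unit speed). A request $q=(x^s,x^d,r)$ has a start $x^s\in X$, a destination $x^d\in X$ and a release date $r\ge 0$, at which it becomes known. A server of capacity one starts in $o$ at time $0$, moves with speed at most $1$, and must serve every request of a finite set $R$: pick it up at $x^s$ at some time $t\ge r$ and carry it without interruption, in time $d(x^s,x^d)$, to $x^d$. The makespan is the first time at which all of $R$ has been served and the server is back in $o$ (at this moment it receives an end signal). This is OlDARP; OlTSP is the special case in which $x^s=x^d$ for all requests. Let $C^*$ be the optimal offline makespan for $R$. An online algorithm is deterministic and knows at time $t$ only the requests released up to time $t$; it is $\rho$-competitive for OlTSP (OlDARP) if on every instance, in every geodesic metric space with origin, its makespan is at most $\rho$ times the optimum. A learning-augmented algorithm is in addition given at time $0$ a finite set $\hat R$ of predicted requests of the same kind, of arbitrary quality and size; let $\hat C$ be the optimal makespan for $\hat R$. **Cover error.** A $k$-hyperedge cover of $A$ by $B$ is a set of pairs $(A',b)$ with $A'\subseteq A$, $|A'|\le k$ and $b\in B$ such that every $a\in A$ lies in some $A'$; for a cost function $\gamma$, $\Gamma_k(A,B)$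 is the minimum of $\sum\gamma(A',b)$ over all such covers ($\infty$ if there is none). Let $\gamma^{\mathrm{TSP}}(R',(x,t))$ be the minimum duration of a tour that starts in $x$ at time $t$, serves $R'$ and returns to $x$. For OlTSP the cost of $(R',b)$ with $b=(x,x,r)$ is $\gamma^{\mathrm{TSP}}(R',(x,r))$. For OlDARP the cost with additive term $D'$ is $0$ if $R'=\{b\}$, and otherwise, with $b=(x^s,x^d,r)$, it is $\min\{\gamma^{\mathrm{TSP}}(R',(x^s,r)),\gamma^{\mathrm{TSP}}(R',(x^d,r+d(x^s,x^d)))\}+D'$. The 1-hyperedge cover error is $\Lambda_1=\Gamma_\infty(\hat R,R)+\Gamma_1(R,\hat R)$, where for OlDARP $D'=0$ in the first term and $D'=\max_{(x^s,x^d,r)\in R\cap\hat R}d(x^s,x^d)$ (or $0$ if $R\cap \hat R=\emptyset$) in the second term. **Algorithm.** The framework ALGOGEN with trust parameter $\alpha>0$ and an online algorithm $\mathcal A$ as a subroutine works in three phases. (i) Follow $\mathcal A$ as long as the time $t$ and the position $p(t)$ satisfy $t\le\alpha\hat C-d(p(t),o)$; a request is picked up only when $\mathcal A$ does so, and only if it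 can be served with the server back in $o$ by time $\alpha\hat C$. (ii) Move straight to $o$, which is reached at time $\alpha\hat C$. (iii) Compute, and follow, a fastest tour from the current position to $o$ that serves (respecting release dates) all predicted requests and all released actual requests that have not been served yet. Recompute it whenever a request of $R\setminus\hat R$ is released, or, if the server is on a ride at that time, as soon as the server is not on a ride. Predicted requests are treated like actual ones throughout phase (iii), whether or not they show up. **Theorem.** Let $\alpha>0$, and let $\mathcal A$ be a $\rho$-competitive online algorithm for OlTSP (respectively OlDARP). For every geodesic metric space with origin and every finite set $\hat R$ of predicted requests, ALGOGEN with trust parameter $\alpha$ and subroutine $\mathcal A$ can be realized as an online algorithm, and however ties between fastest tours are broken, its makespan on every finite set $R$ of actual requests is at most $$(1+\alpha)\,\bigl(C^*+3\Lambda_1\bigr)\qquad\text{and at most}\qquad\Bigl(1+\rho+\frac{\rho}{\alpha}\Bigr)C^*.$$ That is, for $C^*>0$ its competitive ratio is at most $\min\bigl\{(1+\alpha)\bigl(1+\tfrac{3\Lambda_1}{C^*}\bigr),\;1+\rho+\tfrac{\rho}{\alpha}\bigr\}$. -/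

import Mathlib

open scoped ENNReal NNReal

universe u

namespace OnlineRouting

/-- A metric space with an origin in which a server can travel at unit speed: any two points are
joined by a geodesic. -/
structure ServerSpace where
  Point : Type u
  [metric : MetricSpace Point]
  origin : Point
  geodesic : ∀ x y : Point, ∃ g : ℝ → Point, g 0 = x ∧ g (dist x y) = y ∧
    ∀ s ∈ Set.Icc 0 (dist x y), ∀ t ∈ Set.Icc 0 (dist x y), dist (g s) (g t) = |s - t|

attribute [instance] ServerSpace.metric

/-- A transportation request `(x^s, x^d, r)`. -/
@[ext]
structure Request (X : Type u) where
  src : X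
  dst : X
  release : ℝ
  release_nonneg : 0 ≤ release

/-- The two problems: dial-a-ride, and the travelling salesperson problem, which is the case
in which start and destination of every request are equal. -/
inductive Problem where
  | OlTSP
  | OlDARP

section Definitions

variable {X : Type u} [MetricSpace X]

/-- The length of the ride of a request. -/
def Request.len (q : Request X) : ℝ := dist q.src q.dst

/-- The requests that may occur in instances of the given problem. -/
def Problem.Admits (P : Problem) (R : Finset (Request X)) : Prop :=
  match P with
  | .OlTSP => ∀ q ∈ R, q.src = q.dst
  | .OlDARP => True

/-! ### Offline tours -/

/-- `(p, k)` is a tour that starts in `x` at time `t₀`, serves all requests of `S`, reaches `y` at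
the time `c` after that and then stays in `y`. Here `p t` is the position of the server at time
`t`, and `k q` the time at which `q ∈ S` is picked up. A request is not picked up before its
release date; its ride takes time exactly `q.len`, so it is direct and not interrupted; and two
rides do not overlap (the server has capacity one). -/
structure IsTour (x : X) (t₀ : ℝ) (y : X) (S : Set (Request X)) (c : ℝ)
    (p : ℝ → X) (k : Request X → ℝ) : Prop where
  start_le : t₀ ≤ c
  start : p t₀ = x
  rest : ∀ t, c ≤ t → p t = y
  speed : ∀ s t, t₀ ≤ s → s ≤ t → dist (p s) (p t) ≤ t - s
  start_le_pick : ∀ q ∈ S, t₀ ≤ k q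
  release_le : ∀ q ∈ S, q.release ≤ k q
  pick_up : ∀ q ∈ S, p (k q) = q.src
  deliver : ∀ q ∈ S, p (k q + q.len) = q.dst
  deliver_le : ∀ q ∈ S, k q + q.len ≤ c
  capacity : ∀ q ∈ S, ∀ q' ∈ S, q ≠ q' → k q + q.len ≤ k q' ∨ k q' + q'.len ≤ k q

/-- The completion times of tours from `x` at time `t₀` to `y` through `S`. -/
def tourTimes (x : X) (t₀ : ℝ) (y : X) (S : Set (Request X)) : Set ℝ :=
  {c | ∃ p k, IsTour x t₀ y S c p k}

/-- The optimal makespan for the request set `R`, when the server starts in the origin `o` at time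
`0` and has to return to `o`. -/
noncomputable def opt (o : X) (R : Finset (Request X)) : ℝ :=
  sInf (tourTimes o 0 o (R : Set (Request X)))

/-! ### The cover error -/

/-- The optimal makespan for serving `S` from origin `x` and initial time `t`, measured from `t`
on. -/
noncomputable def gammaTSP (S : Finset (Request X)) (x : X) (t : ℝ) : ℝ :=
  sInf (tourTimes x t x (S : Set (Request X))) - t

open scoped Classical in
/-- The hyperedge cost of dial-a-ride with additive term `D`; a request covers itself for free. -/
noncomputable def gammaDaRP (D : ℝ) (S : Finset (Request X)) (b : Request X) : ℝ :=
  if S = {b} then 0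
  else min (gammaTSP S b.src b.release) (gammaTSP S b.dst (b.release + b.len)) + D

open scoped Classical in
/-- The maximum transportation distance in `R ∩ R'` (zero if the intersection is empty). -/
noncomputable def maxCommonLen (R R' : Finset (Request X)) : ℝ :=
  ((R ∩ R').sup fun q => nndist q.src q.dst : ℝ≥0)

/-- `H` is a `k`-hyperedge cover of `A` by `B`: each hyperedge `(A', b)` consists of at most `k`
elements `A'` of `A` and of one element `b` of `B`. -/
def IsCover (k : ℕ∞) (A B : Finset (Request X)) (H : Finset (Finset (Request X) × Request X)) :
    Prop :=
  (∀ h ∈ H, h.1 ⊆ A ∧ (h.1.card : ℕ∞) ≤ k ∧ h.2 ∈ B) ∧ ∀ a ∈ A, ∃ h ∈ H, a ∈ h.1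

/-- The value `Γ_k(A, B)` of a minimum-cost `k`-hyperedge cover of `A` by `B`; it is `∞` if there
is no such cover. -/
noncomputable def coverValue (k : ℕ∞) (cost : Finset (Request X) → Request X → ℝ)
    (A B : Finset (Request X)) : ℝ≥0∞ :=
  ⨅ (H : Finset (Finset (Request X) × Request X)) (_ : IsCover k A B H),
    ∑ h ∈ H, ENNReal.ofReal (cost h.1 h.2)

/-- The cover error `Λ_k(R, R̂) = Γ_∞(R̂, R) + Γ_k(R, R̂)`. For dial-a-ride, the additional term
`D` is charged only for covering actual requests. -/
noncomputable def coverError (P : Problem) (k : ℕ∞) (R Rhat : Finset (Request X)) : ℝ≥0∞ :=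
  match P with
  | .OlTSP =>
      coverValue ⊤ (fun S b => gammaTSP S b.src b.release) Rhat R +
      coverValue k (fun S b => gammaTSP S b.src b.release) R Rhat
  | .OlDARP =>
      coverValue ⊤ (gammaDaRP 0) Rhat R +
      coverValue k (gammaDaRP (maxCommonLen R Rhat)) R Rhat

/-! ### Online algorithms -/

/-- What a server does: its position at each time `t ≥ 0`, and the time at which it picks up
a request (`none` if it never does). -/
structure Schedule (X : Type u) where
  pos : ℝ → X
  pick : Request X → Option ℝ

/-- The schedule can be carried out by a server of unit speed and capacity one that starts in `o`
at time `0`; `V` is the set of requests that may be picked up. -/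
structure Schedule.Feasible (σ : Schedule X) (o : X) (V : Set (Request X)) : Prop where
  start : σ.pos 0 = o
  speed : ∀ s t, 0 ≤ s → s ≤ t → dist (σ.pos s) (σ.pos t) ≤ t - s
  mem : ∀ q s, σ.pick q = some s → q ∈ V
  release_le : ∀ q s, σ.pick q = some s → q.release ≤ s
  pick_up : ∀ q s, σ.pick q = some s → σ.pos s = q.src
  deliver : ∀ q s, σ.pick q = some s → σ.pos (s + q.len) = q.dst
  capacity : ∀ q s q' s', σ.pick q = some s → σ.pick q' = some s' → q ≠ q' →
    s + q.len ≤ s' ∨ s' + q'.len ≤ s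

/-- At time `t` the server is in the origin and has served all requests of `R`. -/
def Schedule.DoneAt (σ : Schedule X) (o : X) (R : Finset (Request X)) (t : ℝ) : Prop :=
  0 ≤ t ∧ σ.pos t = o ∧ ∀ q ∈ R, ∃ s, σ.pick q = some s ∧ s + q.len ≤ t

/-- The makespan: the first time at which the server is back in the origin after it has served
all requests of `R` (`∞` if that never happens). This is also when the end signal is given, so
nothing that a schedule does later matters. -/
noncomputable def Schedule.makespan (σ : Schedule X) (o : X) (R : Finset (Request X)) : ℝ≥0∞ :=
  ⨅ (t : ℝ) (_ : σ.DoneAt o R t), ENNReal.ofReal t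

/-- A deterministic online algorithm: what it does up to time `t` depends only on the requests that
are released up to time `t`. A learning-augmented algorithm, which is given the predicted requests
`V`, may also treat these as requests and go through the motions of serving them, no matter whether
they show up; `V = ∅` for an algorithm without predictions. -/
structure OnlineAlgorithm (o : X) (V : Finset (Request X)) where
  run : Finset (Request X) → Schedule X
  feasible : ∀ R, (run R).Feasible o {q | q ∈ R ∨ q ∈ V}
  causal : ∀ R R' : Finset (Request X), ∀ t : ℝ,
    (∀ q : Request X, q.release ≤ t → (q ∈ R ↔ q ∈ R')) →
    (∀ s, 0 ≤ s → s ≤ t → (run R).pos s = (run R').pos s) ∧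
    ∀ q s, s ≤ t → ((run R).pick q = some s ↔ (run R').pick q = some s)

/-- For every instance of `P` the algorithm has makespan at most `ρ` times the optimum. -/
def OnlineAlgorithm.IsCompetitive {o : X} {V : Finset (Request X)} (A : OnlineAlgorithm o V)
    (P : Problem) (ρ : ℝ) : Prop :=
  ∀ R : Finset (Request X), P.Admits R →
    ((A.run R).makespan o R) ≤ ENNReal.ofReal (ρ * opt o R)

/-! ### The framework -/

/-- At time `t` the server is on a ride. -/
def Schedule.Busy (σ : Schedule X) (t : ℝ) : Prop :=
  ∃ q s, σ.pick q = some s ∧ s < t ∧ t < s + q.len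

/-- The predicted requests and the requests released up to time `τ`, except those picked up before
time `τ`. -/
def pending (σ : Schedule X) (Rhat R : Finset (Request X)) (τ : ℝ) : Set (Request X) :=
  {q | (q ∈ Rhat ∨ (q ∈ R ∧ q.release ≤ τ)) ∧ ¬ ∃ s, s < τ ∧ σ.pick q = some s}

/-- The times at which a tour is computed, when the strategy is started at time `T`: time `T`, and
for every unexpected request released after `T` the first time from its release on at which the
server is not on a ride. -/
def IsReplanTime (σ : Schedule X) (Rhat R : Finset (Request X)) (T τ : ℝ) : Prop :=
  τ = T ∨ ∃ q ∈ R, q ∉ Rhat ∧ T < q.release ∧ q.release ≤ τ ∧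
    ¬ σ.Busy τ ∧ ∀ t, q.release ≤ t → t < τ → σ.Busy t

/-- From time `T` on the schedule follows the strategy PredictReplan: at each replanning time, it
computes a fastest tour from the current position to the origin through all pending requests
(with their release dates), and follows it up to the next replanning time. -/
def FollowsPredictReplan (o : X) (σ : Schedule X) (Rhat R : Finset (Request X)) (T : ℝ) : Prop :=
  ∀ τ, IsReplanTime σ Rhat R T τ →
    ∃ c p k, IsTour (σ.pos τ) τ o (pending σ Rhat R τ) c p k ∧
      IsLeast (tourTimes (σ.pos τ) τ o (pending σ Rhat R τ)) c ∧
      (∀ t, τ ≤ t → (∀ τ', IsReplanTime σ Rhat R T τ' → τ < τ' → t ≤ τ') → σ.pos t = p t) ∧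
      (∀ q s, τ ≤ s → (∀ τ', IsReplanTime σ Rhat R T τ' → τ < τ' → s < τ') →
        (σ.pick q = some s ↔ q ∈ pending σ Rhat R τ ∧ k q = s))

/-- `σ` is a run of the framework with trust parameter `α` on actual requests `R` and predicted
requests `R̂`, where `a` is the schedule of the subroutine on `R`. With `T = α Ĉ`:
(i) the server follows `a` as long as `t ≤ T - d(a(t), o)`, and picks up a request that `a` picks up
only if it can serve it and be back in the origin by time `T`;
(ii) then it moves straight to the origin, which it reaches at time `T`, since
`t + d(a(t), o) = T` at the end of (i);
(iii) from time `T` on it follows the strategy PredictReplan. -/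
structure IsAlgoGenRun (o : X) (α : ℝ) (a σ : Schedule X) (Rhat R : Finset (Request X)) :
    Prop where
  follow : ∀ t, 0 ≤ t → t + dist (a.pos t) o ≤ α * opt o Rhat → σ.pos t = a.pos t
  follow_pick : ∀ q s, s < α * opt o Rhat →
    (σ.pick q = some s ↔
      a.pick q = some s ∧ s + q.len + dist q.dst o ≤ α * opt o Rhat)
  go_home : ∀ t, 0 ≤ t → t ≤ α * opt o Rhat → α * opt o Rhat < t + dist (a.pos t) o →
    t + dist (σ.pos t) o = α * opt o Rhat
  replan : FollowsPredictReplan o σ Rhat R (α * opt o Rhat)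

/-- The learning-augmented algorithm `B`, given the predicted requests `R̂`, is an instance of the
framework for `P` with trust parameter `α` and subroutine `A` (fastest tours need not be unique,
so there may be several instances). -/
def IsAlgoGen {o : X} (P : Problem) (α : ℝ) (A : OnlineAlgorithm o ∅) (Rhat : Finset (Request X))
    (B : OnlineAlgorithm o Rhat) : Prop :=
  ∀ R : Finset (Request X), P.Admits R → IsAlgoGenRun o α (A.run R) (B.run R) Rhat R

end Definitions

end OnlineRouting

open OnlineRouting

namespace OnlineRouting

/-! Let T = αĈ. After the last replanning no unexpected request appears, so the completion time of
the tour computed then bounds the makespan (`exists_last_isReplanTime`); both bounds estimate this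
time.

Robustness (`IsAlgoGenRun.robust`). If the subroutine finishes before T, it is copied to the end.
Otherwise T ≤ ρC*, so Ĉ ≤ (ρ/α)C*. When replanning at time τ, one option is to go home and then to
run optimal tours for R and for R̂. For τ = T this ends by T + C* + Ĉ. For τ > T some request was
released after T, so αĈ < C*, and the server can be home by 2C* + Ĉ; the total 3C* + 2Ĉ is within
the bound because ρ ≥ 2. This inequality is itself a consequence of competitiveness in all geodesic
spaces, by an adversary argument (`two_le_of_isCompetitive`).

Consistency (`completion_le`, `completion_le_of_next`). The tour computed at T needs at most Ĉ plus
the cost of inserting unexpected requests. An unexpected q is charged to a predicted b that covers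
it at cost γ. If b is still to be served, a loop of length γ is inserted there. If b has been
served, the server returns to it: the way is no longer than the time elapsed before the release of
q, and this waiting is contained in γ, together with the ride of q. The way there and back and the
loop cost at most 3γ - 2 len(q) (`IsPlan.insert_detours`). If q appears during a ride w, the way is
measured from the start of w, which adds 2 len(w). This is paid by D if w is actual and predicted,
by the saved 2 len(w) if w was itself unexpected, and by Γ_∞(R̂, R) if w is predicted and never
appears, since that cover value bounds the total length of such rides. Finally Ĉ ≤ C* + Γ_∞(R̂, R),
by inserting the hyperedges into an optimal tour.

Existence of a realization is a recursion that removes the latest unexpected requests. Tours are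
picked by a fixed choice function of position, time and pending set, so equal pasts have equal
continuations. -/

/-- Any two points are joined by a geodesic. -/
def IsGeodesic (X : Type u) [MetricSpace X] : Prop :=
  ∀ x y : X, ∃ g : ℝ → X, g 0 = x ∧ g (dist x y) = y ∧
    ∀ s ∈ Set.Icc 0 (dist x y), ∀ t ∈ Set.Icc 0 (dist x y), dist (g s) (g t) = |s - t|

variable {X : Type u} [MetricSpace X]

theorem Request.len_nonneg (q : Request X) : 0 ≤ q.len := dist_nonneg

/-- The pick-up times `k` can be realized by a tour from `x` at time `t₀` to `y` with completion
time `c`: between consecutive rides there is enough time to travel. -/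
structure IsPlan (x : X) (t₀ : ℝ) (y : X) (S : Set (Request X)) (c : ℝ)
    (k : Request X → ℝ) : Prop where
  start_le : t₀ + dist x y ≤ c
  start : ∀ q ∈ S, t₀ + dist x q.src ≤ k q
  release : ∀ q ∈ S, q.release ≤ k q
  finish : ∀ q ∈ S, k q + q.len + dist q.dst y ≤ c
  order : ∀ q ∈ S, ∀ q' ∈ S, q ≠ q' →
    k q + q.len + dist q.dst q'.src ≤ k q' ∨ k q' + q'.len + dist q'.dst q.src ≤ k q

/-! ### Tours described by pick-up times -/

section Tours

variable {x y z : X} {t₀ c θ δ : ℝ} {S S' : Set (Request X)} {k k' : Request X → ℝ} {p : ℝ → X}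

theorem IsTour.isPlan (h : IsTour x t₀ y S c p k) : IsPlan x t₀ y S c k where
  start_le := by
    have := h.speed t₀ c le_rfl h.start_le
    rw [h.start, h.rest c le_rfl] at this
    linarith
  start q hq := by
    have := h.speed t₀ (k q) le_rfl (h.start_le_pick q hq)
    rw [h.start, h.pick_up q hq] at this
    linarith
  release := h.release_le
  finish q hq := by
    have := h.speed (k q + q.len) c (by linarith [h.start_le_pick q hq, q.len_nonneg])
      (h.deliver_le q hq)
    rw [h.deliver q hq, h.rest c le_rfl] at this
    linarith
  order q hq q' hq' hne := by
    rcases h.capacity q hq q' hq' hne with h1 | h1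
    · left
      have := h.speed (k q + q.len) (k q') (by linarith [h.start_le_pick q hq, q.len_nonneg]) h1
      rw [h.deliver q hq, h.pick_up q' hq'] at this
      linarith
    · right
      have := h.speed (k q' + q'.len) (k q) (by linarith [h.start_le_pick q' hq', q'.len_nonneg]) h1
      rw [h.deliver q' hq', h.pick_up q hq] at this
      linarith

theorem exists_path_extend (hX : IsGeodesic X) (p : ℝ → X) (m : ℝ)
    (hp : ∀ s t, s ≤ t → dist (p s) (p t) ≤ t - s)
    (tₐ : ℝ) (a : X) (hma : m ≤ tₐ) (ha : dist (p m) a ≤ tₐ - m) :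
    ∃ p' : ℝ → X, (∀ s t, s ≤ t → dist (p' s) (p' t) ≤ t - s) ∧ (∀ t, t ≤ m → p' t = p t) ∧
      ∀ t, tₐ ≤ t → p' t = a := by
  obtain ⟨g, g0, g1, hg⟩ := hX (p m) a
  set d := dist (p m) a with hd
  have hd0 : 0 ≤ d := dist_nonneg
  have key : ∀ s t, 0 ≤ s → s ≤ t → dist (g (min s d)) (g (min t d)) ≤ t - s := by
    intro s t hs hst
    rw [hg _ ⟨le_min hs hd0, min_le_right _ _⟩ _ ⟨le_min (hs.trans hst) hd0, min_le_right _ _⟩]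
    rw [abs_le]
    constructor <;>
    · rcases le_total s d with h1 | h1 <;> rcases le_total t d with h2 | h2 <;>
        simp only [min_eq_left, min_eq_right, h1, h2] <;> linarith
  refine ⟨fun t => if t ≤ m then p t else g (min (t - m) d), ?_, ?_, ?_⟩
  · intro s t hst
    by_cases h1 : t ≤ m
    · simp only [h1, hst.trans h1, if_true]
      exact hp s t hst
    · by_cases h2 : s ≤ m
      · simp only [h1, h2, if_true, if_false]
        push Not at h1
        have e1 := hp s m h2
        have e2 := key 0 (t - m) le_rfl (by linarith)
        rw [min_eq_left hd0, g0] at e2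
        linarith [dist_triangle (p s) (p m) (g (min (t - m) d))]
      · simp only [h1, h2, if_false]
        push Not at h1 h2
        linarith [key (s - m) (t - m) (by linarith) (by linarith)]
  · intro t ht
    simp [ht]
  · intro t ht
    by_cases h : t ≤ m
    · simp only [h, if_true]
      have h2 : tₐ = m := by linarith
      have h1 : t = m := by linarith
      rw [h1]
      exact dist_le_zero.1 (by linarith)
    · simp only [h, if_false]
      rw [min_eq_right (by linarith), g1]

/-- Waypoints are added in the order of time, each reached by a geodesic from the latest one so far.
The last clause is needed for `IsTour.rest`. -/
theorem exists_path (hX : IsGeodesic X) (x₀ : X) (W : Finset (ℝ × X))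
    (hW : ∀ v ∈ W, ∀ w ∈ W, v.1 ≤ w.1 → dist v.2 w.2 ≤ w.1 - v.1) :
    ∃ p : ℝ → X, (∀ s t, s ≤ t → dist (p s) (p t) ≤ t - s) ∧ (∀ w ∈ W, p w.1 = w.2) ∧
      ∀ w ∈ W, (∀ v ∈ W, v.1 ≤ w.1) → ∀ t, w.1 ≤ t → p t = w.2 := by
  classical
  revert hW
  refine Finset.induction_on_max_value (Prod.fst : ℝ × X → ℝ) W
    (fun _ => ⟨fun _ => x₀, by simp, by simp, by simp⟩) ?_
  · intro a s has hle ih hW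
    obtain ⟨p, hp, hps, -⟩ := ih fun v hv w hw =>
      hW v (Finset.mem_insert_of_mem hv) w (Finset.mem_insert_of_mem hw)
    have fin : ∃ p' : ℝ → X, (∀ s t, s ≤ t → dist (p' s) (p' t) ≤ t - s) ∧
        (∀ w ∈ s, p' w.1 = w.2) ∧ ∀ t, a.1 ≤ t → p' t = a.2 := by
      rcases s.eq_empty_or_nonempty with rfl | hne
      · exact ⟨fun _ => a.2, by simp, by simp, by simp⟩
      · obtain ⟨m, hm, hmax⟩ := s.exists_max_image Prod.fst hne
        have hpm := hps m hm
        obtain ⟨p', h1, h2, h3⟩ := exists_path_extend hX p m.1 hp a.1 a.2 (hle m hm)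
          (by rw [hpm]
              exact hW m (Finset.mem_insert_of_mem hm) a (Finset.mem_insert_self _ _) (hle m hm))
        exact ⟨p', h1, fun w hw => by rw [h2 _ (hmax w hw), hps w hw], h3⟩
    obtain ⟨p', h1, h2, h3⟩ := fin
    have hall : ∀ w ∈ insert a s, p' w.1 = w.2 := by
      intro w hw
      rcases Finset.mem_insert.1 hw with rfl | hw
      · exact h3 _ le_rfl
      · exact h2 w hw
    refine ⟨p', h1, hall, ?_⟩
    intro w hw hwm t ht
    have e := hwm a (Finset.mem_insert_self _ _)
    rw [h3 t (e.trans ht), ← hall w hw, h3 _ e]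

/-- The waypoints are the start, the end, and both endpoints of every ride; the inequalities of the
plan and the triangle inequality make every pair of them compatible. -/
theorem IsPlan.exists_isTour (hX : IsGeodesic X) (hS : S.Finite) (h : IsPlan x t₀ y S c k) :
    ∃ p, IsTour x t₀ y S c p k := by
  classical
  have hlen : ∀ q : Request X, dist q.src q.dst = q.len := fun _ => rfl
  let W : Finset (ℝ × X) := {(t₀, x), (c, y)} ∪ (hS.toFinset.image (fun q => (k q, q.src)) ∪
    hS.toFinset.image (fun q => (k q + q.len, q.dst)))
  have memW : ∀ w, w ∈ W ↔ (w = (t₀, x) ∨ w = (c, y)) ∨ (∃ q ∈ S, (k q, q.src) = w) ∨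
      ∃ q ∈ S, (k q + q.len, q.dst) = w := by
    intro w; simp [W, or_assoc]
  have hsl := h.start_le
  have hS1 : ∀ q ∈ S, t₀ ≤ k q := fun q hq => by
    linarith [h.start q hq, dist_nonneg (x := x) (y := q.src)]
  have hS2 : ∀ q ∈ S, k q + q.len ≤ c := fun q hq => by
    linarith [h.finish q hq, dist_nonneg (x := q.dst) (y := y)]
  have dxy := dist_nonneg (x := x) (y := y)
  have hW : ∀ v ∈ W, ∀ w ∈ W, v.1 ≤ w.1 → dist v.2 w.2 ≤ w.1 - v.1 := by
    -- The absolute value avoids putting each pair of waypoints in temporal order.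
    have pos : ∀ v ∈ W, ∀ w ∈ W, dist v.2 w.2 ≤ |w.1 - v.1| := by
      have sym : ∀ v w : ℝ × X, dist v.2 w.2 ≤ |w.1 - v.1| → dist w.2 v.2 ≤ |v.1 - w.1| := by
        intro v w hvw; rwa [dist_comm, abs_sub_comm]
      have fwd : ∀ (v w : ℝ × X), dist v.2 w.2 ≤ w.1 - v.1 → dist v.2 w.2 ≤ |w.1 - v.1| :=
        fun v w hvw => hvw.trans (le_abs_self _)
      have a1 : ∀ q ∈ S, dist x q.src ≤ |k q - t₀| := fun q hq =>
        fwd (t₀, x) (k q, q.src) (by dsimp only; linarith [h.start q hq])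
      have a2 : ∀ q ∈ S, dist x q.dst ≤ |k q + q.len - t₀| := fun q hq =>
        fwd (t₀, x) (k q + q.len, q.dst) (by
          dsimp only; linarith [h.start q hq, dist_triangle x q.src q.dst, hlen q])
      have b1 : ∀ q ∈ S, dist q.src y ≤ |c - k q| := fun q hq =>
        fwd (k q, q.src) (c, y) (by
          dsimp only; linarith [h.finish q hq, dist_triangle q.src q.dst y, hlen q])
      have b2 : ∀ q ∈ S, dist q.dst y ≤ |c - (k q + q.len)| := fun q hq =>
        fwd (k q + q.len, q.dst) (c, y) (by dsimp only; linarith [h.finish q hq])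
      have ss : ∀ q ∈ S, ∀ q' ∈ S, dist q.src q'.src ≤ |k q' - k q| := by
        intro q hq q' hq'
        by_cases hne : q = q'
        · subst hne; simp
        rcases h.order q hq q' hq' hne with e | e
        · exact fwd (k q, q.src) (k q', q'.src) (by
            dsimp only; linarith [dist_triangle q.src q.dst q'.src, hlen q])
        · exact sym (k q', q'.src) (k q, q.src) (fwd _ _ (by
            dsimp only; linarith [dist_triangle q'.src q'.dst q.src, hlen q']))
      have sd : ∀ q ∈ S, ∀ q' ∈ S, dist q.src q'.dst ≤ |k q' + q'.len - k q| := by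
        intro q hq q' hq'
        by_cases hne : q = q'
        · subst hne; rw [hlen, add_sub_cancel_left]; exact le_abs_self _
        rcases h.order q hq q' hq' hne with e | e
        · exact fwd (k q, q.src) (k q' + q'.len, q'.dst) (by
            dsimp only
            linarith [dist_triangle q.src q.dst q'.dst, dist_triangle q.dst q'.src q'.dst,
              hlen q, hlen q'])
        · exact sym (k q' + q'.len, q'.dst) (k q, q.src) (fwd _ _ (by
            dsimp only; linarith))
      have dd : ∀ q ∈ S, ∀ q' ∈ S, dist q.dst q'.dst ≤ |k q' + q'.len - (k q + q.len)| := by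
        intro q hq q' hq'
        by_cases hne : q = q'
        · subst hne; simp
        rcases h.order q hq q' hq' hne with e | e
        · exact fwd (k q + q.len, q.dst) (k q' + q'.len, q'.dst) (by
            dsimp only; linarith [dist_triangle q.dst q'.src q'.dst, hlen q'])
        · exact sym (k q' + q'.len, q'.dst) (k q + q.len, q.dst) (fwd _ _ (by
            dsimp only; linarith [dist_triangle q'.dst q.src q.dst, hlen q]))
      have xy : dist x y ≤ |c - t₀| := le_trans (by linarith) (le_abs_self _)
      intro v hv w hw
      rw [memW] at hv hw
      rcases hv with (rfl | rfl) | ⟨q, hq, rfl⟩ | ⟨q, hq, rfl⟩ <;>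
      rcases hw with (rfl | rfl) | ⟨q', hq', rfl⟩ | ⟨q', hq', rfl⟩
      · simp
      · exact xy
      · exact a1 _ hq'
      · exact a2 _ hq'
      · exact sym (t₀, x) (c, y) xy
      · simp
      · exact sym (k q', q'.src) (c, y) (b1 _ hq')
      · exact sym (k q' + q'.len, q'.dst) (c, y) (b2 _ hq')
      · exact sym (t₀, x) (k q, q.src) (a1 _ hq)
      · exact b1 _ hq
      · exact ss _ hq _ hq'
      · exact sd _ hq _ hq'
      · exact sym (t₀, x) (k q + q.len, q.dst) (a2 _ hq)
      · exact b2 _ hq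
      · exact sym (k q', q'.src) (k q + q.len, q.dst) (sd _ hq' _ hq)
      · exact dd _ hq _ hq'
    intro v hv w hw hvw
    have := pos v hv w hw
    rwa [abs_of_nonneg (by linarith)] at this
  obtain ⟨p, hp, hpW, hlast⟩ := exists_path hX x W hW
  have hcW : (c, y) ∈ W := by simp [W]
  refine ⟨p, by linarith, hpW (t₀, x) (by simp [W]), fun t ht => hlast (c, y) hcW ?_ t ht,
    fun s t _ hst => hp s t hst, hS1, h.release, fun q hq => hpW (k q, q.src) ?_,
    fun q hq => hpW (k q + q.len, q.dst) ?_, hS2, ?_⟩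
  · intro v hv
    rw [memW] at hv
    rcases hv with (rfl | rfl) | ⟨q, hq, rfl⟩ | ⟨q, hq, rfl⟩
    · dsimp only; linarith
    · exact le_rfl
    · dsimp only; linarith [hS2 q hq, q.len_nonneg]
    · exact hS2 q hq
  · rw [memW]; exact Or.inr (Or.inl ⟨q, hq, rfl⟩)
  · rw [memW]; exact Or.inr (Or.inr ⟨q, hq, rfl⟩)
  · intro q hq q' hq' hne
    have d1 := dist_nonneg (x := q.dst) (y := q'.src)
    have d2 := dist_nonneg (x := q'.dst) (y := q.src)
    rcases h.order q hq q' hq' hne with e | e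
    · left; linarith
    · right; linarith

/-- Completion times can thus be estimated by manipulating pick-up times, without touching paths. -/
theorem mem_tourTimes (hX : IsGeodesic X) (hS : S.Finite) :
    c ∈ tourTimes x t₀ y S ↔ ∃ k, IsPlan x t₀ y S c k :=
  ⟨fun ⟨_, k, h⟩ => ⟨k, h.isPlan⟩, fun ⟨k, h⟩ => (h.exists_isTour hX hS).imp fun _ hp => ⟨k, hp⟩⟩

theorem IsPlan.mono (h : IsPlan x t₀ y S c k) (hS : S' ⊆ S) : IsPlan x t₀ y S' c k :=
  ⟨h.start_le, fun q hq => h.start q (hS hq), fun q hq => h.release q (hS hq),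
    fun q hq => h.finish q (hS hq), fun q hq q' hq' => h.order q (hS hq) q' (hS hq')⟩

theorem IsPlan.le (h : IsPlan x t₀ y S c k) {c' : ℝ} (hc : c ≤ c') : IsPlan x t₀ y S c' k :=
  ⟨h.start_le.trans hc, h.start, h.release, fun q hq => (h.finish q hq).trans hc, h.order⟩

theorem IsPlan.congr (h : IsPlan x t₀ y S c k) (hk : ∀ q ∈ S, k' q = k q) :
    IsPlan x t₀ y S c k' := by
  refine ⟨h.start_le, fun q hq => ?_, fun q hq => ?_, fun q hq => ?_, fun q hq q' hq' hne => ?_⟩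
  · rw [hk q hq]; exact h.start q hq
  · rw [hk q hq]; exact h.release q hq
  · rw [hk q hq]; exact h.finish q hq
  · rw [hk q hq, hk q' hq']; exact h.order q hq q' hq' hne

theorem IsPlan.shift (h : IsPlan x t₀ y S c k) (hδ : 0 ≤ δ) :
    IsPlan x (t₀ + δ) y S (c + δ) (fun q => k q + δ) := by
  refine ⟨by linarith [h.start_le], fun q hq => by linarith [h.start q hq],
    fun q hq => by linarith [h.release q hq], fun q hq => by linarith [h.finish q hq],
    fun q hq q' hq' hne => ?_⟩
  rcases h.order q hq q' hq' hne with e | e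
  · left; linarith
  · right; linarith

theorem isPlan_empty (h : t₀ + dist x y ≤ c) (k : Request X → ℝ) : IsPlan x t₀ y ∅ c k :=
  ⟨h, by simp, by simp, by simp, by simp⟩

theorem isPlan_singleton {q : Request X} {κ : ℝ} (h0 : t₀ + dist x y ≤ c)
    (h1 : t₀ + dist x q.src ≤ κ)
    (h2 : q.release ≤ κ) (h3 : κ + q.len + dist q.dst y ≤ c) :
    IsPlan x t₀ y {q} c (fun _ => κ) := by
  refine ⟨h0, ?_, ?_, ?_, ?_⟩
  · rintro _ rfl; exact h1
  · rintro _ rfl; exact h2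
  · rintro _ rfl; exact h3
  · rintro _ rfl _ rfl hne; exact absurd rfl hne

/-- First one plan, then another one. -/
theorem IsPlan.trans {c' : ℝ} (h : IsPlan x t₀ y S c k) (h' : IsPlan y c z S' c' k') :
    ∃ k'', IsPlan x t₀ z (S ∪ S') c' k'' := by
  classical
  have e1 := h.start_le
  have e2 := h'.start_le
  refine ⟨fun q => if q ∈ S then k q else k' q, ⟨?_, ?_, ?_, ?_, ?_⟩⟩
  · linarith [dist_triangle x y z]
  · rintro q hq
    by_cases hS : q ∈ S
    · simp only [hS, if_true]; exact h.start q hS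
    · simp only [hS, if_false]
      linarith [h'.start q (hq.resolve_left hS), dist_triangle x y q.src]
  · rintro q hq
    by_cases hS : q ∈ S
    · simp only [hS, if_true]; exact h.release q hS
    · simp only [hS, if_false]; exact h'.release q (hq.resolve_left hS)
  · rintro q hq
    by_cases hS : q ∈ S
    · simp only [hS, if_true]
      linarith [h.finish q hS, dist_triangle q.dst y z]
    · simp only [hS, if_false]; exact h'.finish q (hq.resolve_left hS)
  · intro q hq q' hq' hne
    by_cases hS : q ∈ S <;> by_cases hS' : q' ∈ S <;> simp only [hS, hS', if_true, if_false]
    · exact h.order q hS q' hS' hne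
    · left
      linarith [h.finish q hS, h'.start q' (hq'.resolve_left hS'), dist_triangle q.dst y q'.src]
    · right
      linarith [h.finish q' hS', h'.start q (hq.resolve_left hS), dist_triangle q'.dst y q.src]
    · have e := h'.order q (hq.resolve_left hS) q' (hq'.resolve_left hS') hne
      exact e

/-- At time `θ` the server can be at `z` without being on a ride. -/
structure IsBreak (x : X) (t₀ : ℝ) (y : X) (S : Set (Request X)) (c : ℝ) (k : Request X → ℝ)
    (θ : ℝ) (z : X) : Prop where
  start : t₀ + dist x z ≤ θ
  finish : θ + dist z y ≤ c
  split : ∀ q ∈ S, k q + q.len + dist q.dst z ≤ θ ∨ θ + dist z q.src ≤ k q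

theorem IsPlan.isBreak_src (h : IsPlan x t₀ y S c k) {b : Request X} (hb : b ∈ S) :
    IsBreak x t₀ y S c k (k b) b.src := by
  have hlen : dist b.src b.dst = b.len := rfl
  refine ⟨h.start b hb, ?_, fun q hq => ?_⟩
  · linarith [h.finish b hb, dist_triangle b.src b.dst y]
  · by_cases hne : q = b
    · right; simp [hne]
    · rcases h.order q hq b hb hne with e | e
      · exact Or.inl e
      · right; linarith [dist_triangle b.src b.dst q.src]

theorem IsPlan.isBreak_dst (h : IsPlan x t₀ y S c k) {b : Request X} (hb : b ∈ S) :
    IsBreak x t₀ y S c k (k b + b.len) b.dst := by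
  have hlen : dist b.src b.dst = b.len := rfl
  refine ⟨?_, h.finish b hb, fun q hq => ?_⟩
  · linarith [h.start b hb, dist_triangle x b.src b.dst]
  · by_cases hne : q = b
    · left; simp [hne]
    · rcases h.order q hq b hb hne with e | e
      · left; linarith [dist_triangle q.dst b.src b.dst]
      · exact Or.inr e

/-- What is finished at the break keeps its time, and the rest is postponed by the length `δ` of the
loop; postponing respects release dates. -/
theorem IsPlan.insert_loop (h : IsPlan x t₀ y S c k) (hb : IsBreak x t₀ y S c k θ z)
    (h' : IsPlan z θ z S' (θ + δ) k') : ∃ k'', IsPlan x t₀ y (S ∪ S') (c + δ) k'' := by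
  classical
  have hδ : 0 ≤ δ := by
    have := h'.start_le
    rw [dist_self] at this; linarith
  have b1 := hb.start
  have b2 := hb.finish
  -- A ride of length zero in `z` at time `θ` satisfies both alternatives of `hb.split`; it counts
  -- as done before the loop.
  let B : Request X → Prop := fun q => k q + q.len + dist q.dst z ≤ θ
  have hB : ∀ q ∈ S, ¬ B q → θ + dist z q.src ≤ k q := fun q hq hq' =>
    (hb.split q hq).resolve_left hq'
  refine ⟨fun q => if q ∈ S then (if B q then k q else k q + δ) else k' q, ⟨?_, ?_, ?_, ?_, ?_⟩⟩
  · linarith [h.start_le]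
  · intro q hq
    by_cases hS : q ∈ S
    · have := h.start q hS
      by_cases hq' : B q <;> simp only [hS, hq', if_true, if_false] <;> linarith
    · simp only [hS, if_false]
      linarith [h'.start q (hq.resolve_left hS), dist_triangle x z q.src]
  · intro q hq
    by_cases hS : q ∈ S
    · have := h.release q hS
      by_cases hq' : B q <;> simp only [hS, hq', if_true, if_false] <;> linarith
    · simp only [hS, if_false]
      exact h'.release q (hq.resolve_left hS)
  · intro q hq
    by_cases hS : q ∈ S
    · have := h.finish q hS
      by_cases hq' : B q <;> simp only [hS, hq', if_true, if_false] <;> linarith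
    · simp only [hS, if_false]
      linarith [h'.finish q (hq.resolve_left hS), dist_triangle q.dst z y]
  · intro q hq q' hq' hne
    by_cases hS : q ∈ S <;> by_cases hS' : q' ∈ S
    · by_cases hBq : B q <;> by_cases hBq' : B q' <;>
        simp only [hS, hS', hBq, hBq', if_true, if_false]
      · exact h.order q hS q' hS' hne
      · left; linarith [hB q' hS' hBq', dist_triangle q.dst z q'.src, show _ ≤ θ from hBq]
      · right; linarith [hB q hS hBq, dist_triangle q'.dst z q.src, show _ ≤ θ from hBq']
      · rcases h.order q hS q' hS' hne with e | e
        · left; linarith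
        · right; linarith
    · have hs := h'.start q' (hq'.resolve_left hS')
      have hf := h'.finish q' (hq'.resolve_left hS')
      by_cases hBq : B q <;> simp only [hS, hS', hBq, if_true, if_false]
      · left; linarith [dist_triangle q.dst z q'.src, show _ ≤ θ from hBq]
      · right; linarith [hB q hS hBq, dist_triangle q'.dst z q.src]
    · have hs := h'.start q (hq.resolve_left hS)
      have hf := h'.finish q (hq.resolve_left hS)
      by_cases hBq : B q' <;> simp only [hS, hS', hBq, if_true, if_false]
      · right; linarith [dist_triangle q'.dst z q.src, show _ ≤ θ from hBq]
      · left; linarith [hB q' hS' hBq, dist_triangle q.dst z q'.src]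
    · simp only [hS, hS', if_false]
      exact h'.order q (hq.resolve_left hS) q' (hq'.resolve_left hS') hne

theorem IsPlan.sum_len_le (S : Finset (Request X)) {y : X} {c : ℝ}
    (h : IsPlan x t₀ y (S : Set (Request X)) c k) :
    t₀ + ∑ q ∈ S, q.len ≤ c := by
  classical
  suffices H : ∀ (y : X) (c : ℝ), IsPlan x t₀ y (S : Set (Request X)) c k →
      t₀ + ∑ q ∈ S, q.len ≤ c from H _ _ h
  clear h
  -- Rides are ordered by midpoint: a ride of length zero may share its pick-up or delivery time
  -- with another ride, so neither of these times identifies the last ride. Equal midpoints only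
  -- occur for rides of length zero at the same place.
  refine Finset.induction_on_max_value (fun q : Request X => k q + (k q + q.len)) S ?_ ?_
  · intro y c h
    simpa using le_trans (by linarith [dist_nonneg (x := x) (y := y)]) h.start_le
  · intro a s has hle ih y c h
    rw [Finset.coe_insert] at h
    have ha : a ∈ insert a (s : Set (Request X)) := Set.mem_insert _ _
    have hs : ∀ q ∈ s, q ∈ insert a (s : Set (Request X)) := fun q hq =>
      Set.mem_insert_of_mem _ (Finset.mem_coe.2 hq)
    have := ih a.src (k a) ⟨h.start a ha, fun q hq => h.start q (hs q hq),
      fun q hq => h.release q (hs q hq), fun q hq => ?_, fun q hq q' hq' =>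
        h.order q (hs q hq) q' (hs q' hq')⟩
    · rw [Finset.sum_insert has]
      linarith [h.finish a ha, dist_nonneg (x := a.dst) (y := y)]
    · have hne : q ≠ a := fun e => has (e ▸ Finset.mem_coe.1 hq)
      rcases h.order q (hs q hq) a ha hne with e | e
      · exact e
      · have d0 := dist_nonneg (x := a.dst) (y := q.src)
        have d1 := hle q hq
        have d2 := a.len_nonneg
        have d3 := q.len_nonneg
        have hlen : dist a.src a.dst = a.len := rfl
        have hlen' : dist q.src q.dst = q.len := rfl
        have z1 : a.len = 0 := by linarith
        have z2 : q.len = 0 := by linarith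
        have z3 : dist a.dst q.src = 0 := by linarith
        rw [z1, dist_eq_zero] at hlen
        rw [z2, dist_eq_zero] at hlen'
        rw [dist_eq_zero] at z3
        rw [← hlen', ← z3, ← hlen, dist_self]
        linarith

theorem exists_isPlan (S : Finset (Request X)) (x : X) (t₀ : ℝ) (y : X) :
    ∃ c k, IsPlan x t₀ y (S : Set (Request X)) c k := by
  classical
  induction S using Finset.induction_on with
  | empty => exact ⟨t₀ + dist x y, fun _ => 0, by simpa using isPlan_empty le_rfl _⟩
  | insert a s _ ih =>
    obtain ⟨c, k, h⟩ := ih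
    have h1 := le_max_left c a.release
    have h2 := le_max_right c a.release
    have d1 := dist_nonneg (x := y) (y := a.src)
    have d2 := a.len_nonneg
    have d3 := dist_nonneg (x := a.dst) (y := y)
    obtain ⟨k', h'⟩ := h.trans (isPlan_singleton (q := a) (y := y)
      (κ := max c a.release + dist y a.src)
      (c := max c a.release + dist y a.src + a.len + dist a.dst y)
      (by rw [dist_self]; linarith) (by linarith) (by linarith) le_rfl)
    refine ⟨max c a.release + dist y a.src + a.len + dist a.dst y, k', ?_⟩
    rwa [Finset.coe_insert, Set.insert_eq, Set.union_comm]

theorem isClosed_isPlan (x : X) (t₀ : ℝ) (y : X) (S : Set (Request X)) :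
    IsClosed {v : (Request X → ℝ) × ℝ | IsPlan x t₀ y S v.2 v.1} := by
  have : {v : (Request X → ℝ) × ℝ | IsPlan x t₀ y S v.2 v.1} =
      {v | t₀ + dist x y ≤ v.2} ∩ (⋂ q ∈ S, {v | t₀ + dist x q.src ≤ v.1 q}) ∩
      (⋂ q ∈ S, {v | q.release ≤ v.1 q}) ∩
      (⋂ q ∈ S, {v | v.1 q + q.len + dist q.dst y ≤ v.2}) ∩
      (⋂ q ∈ S, ⋂ q' ∈ S, ⋂ (_ : q ≠ q'), ({v | v.1 q + q.len + dist q.dst q'.src ≤ v.1 q'} ∪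
        {v | v.1 q' + q'.len + dist q'.dst q.src ≤ v.1 q})) := by
    ext v
    simp only [Set.mem_ofPred_eq, Set.mem_inter_iff, Set.mem_iInter, Set.mem_union]
    exact ⟨fun h => ⟨⟨⟨⟨h.start_le, h.start⟩, h.release⟩, h.finish⟩, h.order⟩,
      fun h => ⟨h.1.1.1.1, h.1.1.1.2, h.1.1.2, h.1.2, h.2⟩⟩
  rw [this]
  refine (((IsClosed.inter ?_ ?_).inter ?_).inter ?_).inter ?_
  · exact isClosed_le (by fun_prop) (by fun_prop)
  · exact isClosed_biInter fun q _ => isClosed_le (by fun_prop) (by fun_prop)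
  · exact isClosed_biInter fun q _ => isClosed_le (by fun_prop) (by fun_prop)
  · exact isClosed_biInter fun q _ => isClosed_le (by fun_prop) (by fun_prop)
  · exact isClosed_biInter fun q _ => isClosed_biInter fun q' _ => isClosed_iInter fun _ =>
      (isClosed_le (by fun_prop) (by fun_prop)).union (isClosed_le (by fun_prop) (by fun_prop))

/-- Compactness: the conditions on a plan are closed. Pick-up times outside `S` are irrelevant and
may be set to `t₀`, so all plans that end by `c₀` can be taken from a product of compact intervals.
-/
theorem exists_isLeast_plan (S : Finset (Request X)) (x : X) (t₀ : ℝ) (y : X) :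
    ∃ c, IsLeast {c | ∃ k, IsPlan x t₀ y (S : Set (Request X)) c k} c := by
  classical
  obtain ⟨c₀, k₀, h₀⟩ := exists_isPlan S x t₀ y
  have hc₀ : t₀ ≤ c₀ := by linarith [h₀.start_le, dist_nonneg (x := x) (y := y)]
  set K : Set ((Request X → ℝ) × ℝ) :=
    ((Set.univ.pi fun _ => Set.Icc t₀ c₀) ×ˢ Set.Icc t₀ c₀) ∩
      {v | IsPlan x t₀ y (S : Set (Request X)) v.2 v.1} with hK
  have hKc : IsCompact K :=
    ((isCompact_univ_pi fun _ => isCompact_Icc).prod isCompact_Icc).inter_right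
      (isClosed_isPlan x t₀ y _)
  have mem : ∀ c k, IsPlan x t₀ y (S : Set (Request X)) c k → c ≤ c₀ → ∃ k', (k', c) ∈ K := by
    intro c k h hc
    have htc : t₀ ≤ c := by linarith [h.start_le, dist_nonneg (x := x) (y := y)]
    refine ⟨fun q => if q ∈ S then k q else t₀, ⟨⟨?_, htc, hc⟩, h.congr ?_⟩⟩
    · intro q _
      by_cases hq : q ∈ S
      · simp only [hq, if_true]
        have := h.start q hq
        have := h.finish q hq
        have := q.len_nonneg
        have := dist_nonneg (x := q.dst) (y := y)
        have := dist_nonneg (x := x) (y := q.src)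
        constructor <;> linarith
      · simp only [hq, if_false]; exact ⟨le_rfl, hc₀⟩
    · intro q hq
      exact if_pos (Finset.mem_coe.1 hq)
  obtain ⟨k₁, hk₁⟩ := mem c₀ k₀ h₀ le_rfl
  obtain ⟨v, hv, hmin⟩ := hKc.exists_isMinOn ⟨_, hk₁⟩ continuous_snd.continuousOn
  refine ⟨v.2, ⟨v.1, hv.2⟩, ?_⟩
  rintro c ⟨k, hk⟩
  rcases le_total c c₀ with hc | hc
  · obtain ⟨k', hk'⟩ := mem c k hk hc
    exact hmin hk'
  · exact hv.1.2.2.trans hc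

theorem exists_isLeast_tourTimes (hX : IsGeodesic X) (hS : S.Finite) (x : X) (t₀ : ℝ) (y : X) :
    ∃ c, IsLeast (tourTimes x t₀ y S) c := by
  obtain ⟨c, hc⟩ := exists_isLeast_plan hS.toFinset x t₀ y
  refine ⟨c, ?_⟩
  rw [hS.coe_toFinset] at hc
  convert hc using 1
  ext c'
  exact mem_tourTimes hX hS

theorem isLeast_opt (hX : IsGeodesic X) (o : X) (R : Finset (Request X)) :
    IsLeast (tourTimes o 0 o (R : Set (Request X))) (opt o R) := by
  obtain ⟨c, hc⟩ := exists_isLeast_tourTimes hX R.finite_toSet o 0 o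
  rwa [opt, hc.csInf_eq]

theorem exists_isPlan_opt (hX : IsGeodesic X) (o : X) (R : Finset (Request X)) :
    ∃ k, IsPlan o 0 o (R : Set (Request X)) (opt o R) k :=
  (mem_tourTimes hX R.finite_toSet).1 (isLeast_opt hX o R).1

theorem opt_le (hX : IsGeodesic X) {o : X} {R : Finset (Request X)}
    (h : IsPlan o 0 o (R : Set (Request X)) c k) : opt o R ≤ c :=
  (isLeast_opt hX o R).2 ((mem_tourTimes hX R.finite_toSet).2 ⟨k, h⟩)

theorem opt_nonneg (hX : IsGeodesic X) (o : X) (R : Finset (Request X)) : 0 ≤ opt o R := by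
  obtain ⟨k, h⟩ := exists_isPlan_opt hX o R
  simpa using h.start_le

theorem exists_isPlan_gammaTSP (hX : IsGeodesic X) (S : Finset (Request X)) (x : X) (t : ℝ) :
    ∃ k, IsPlan x t x (S : Set (Request X)) (t + gammaTSP S x t) k := by
  obtain ⟨c, hc⟩ := exists_isLeast_tourTimes hX S.finite_toSet x t x
  rw [gammaTSP, hc.csInf_eq, add_sub_cancel]
  exact (mem_tourTimes hX S.finite_toSet).1 hc.1

theorem gammaTSP_nonneg (hX : IsGeodesic X) (S : Finset (Request X)) (x : X) (t : ℝ) :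
    0 ≤ gammaTSP S x t := by
  obtain ⟨k, h⟩ := exists_isPlan_gammaTSP hX S x t
  simpa using h.start_le

end Tours

/-! ### Minimum covers -/

section Generalities

variable {X : Type u}

theorem sum_biUnion_le {ι κ : Type*} [DecidableEq κ] (s : Finset ι) (t : ι → Finset κ) {f : κ → ℝ}
    (hf : ∀ i, 0 ≤ f i) : ∑ i ∈ s.biUnion t, f i ≤ ∑ j ∈ s, ∑ i ∈ t j, f i := by
  classical
  induction s using Finset.induction_on with
  | empty => simp
  | insert a s ha ih =>
    rw [Finset.biUnion_insert, Finset.sum_insert ha]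
    have := Finset.sum_union_inter (s₁ := t a) (s₂ := s.biUnion t) (f := f)
    have := Finset.sum_nonneg fun i (_ : i ∈ t a ∩ s.biUnion t) => hf i
    linarith

/-- There are only finitely many covers, so the minimum is attained if there is any. -/
theorem coverValue_eq_top_or (n : ℕ∞) (cost : Finset (Request X) → Request X → ℝ)
    (A B : Finset (Request X)) : coverValue n cost A B = ⊤ ∨
      ∃ H, IsCover n A B H ∧ coverValue n cost A B = ∑ h ∈ H, ENNReal.ofReal (cost h.1 h.2) := by
  classical
  have hfin : {H | IsCover n A B H}.Finite := by
    refine ((A.powerset ×ˢ B).powerset.finite_toSet).subset ?_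
    intro H hH
    rw [Finset.mem_coe, Finset.mem_powerset]
    intro h hh
    rw [Finset.mem_product, Finset.mem_powerset]
    exact ⟨(hH.1 h hh).1, (hH.1 h hh).2.2⟩
  rcases Set.eq_empty_or_nonempty {H | IsCover n A B H} with he | hne
  · left
    unfold coverValue
    rw [iInf_eq_top]
    intro H
    rw [iInf_eq_top]
    intro hH
    exact absurd (he ▸ hH : H ∈ (∅ : Set _)) (Set.notMem_empty _)
  · right
    obtain ⟨H, hH, hmin⟩ := Set.exists_min_image _
      (fun H => ∑ h ∈ H, ENNReal.ofReal (cost h.1 h.2)) hfin hne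
    refine ⟨H, hH, le_antisymm (iInf₂_le H hH) (le_iInf₂ fun H' hH' => hmin H' hH')⟩

theorem coverValue_mono {n : ℕ∞} {cost cost' : Finset (Request X) → Request X → ℝ}
    {A B : Finset (Request X)} (h : ∀ A' ⊆ A, ∀ b ∈ B, cost A' b ≤ cost' A' b) :
    coverValue n cost A B ≤ coverValue n cost' A B :=
  iInf₂_mono fun _ hH => Finset.sum_le_sum fun e he =>
    ENNReal.ofReal_le_ofReal (h _ (hH.1 e he).1 _ (hH.1 e he).2.2)

end Generalities

/-! ### Inserting hyperedges into a plan -/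

section Covers

variable {X : Type u} [MetricSpace X]
variable {x y z : X} {t₀ c θ D : ℝ} {S : Set (Request X)} {k : Request X → ℝ}

/-- An optimal loop for time `t` can be started at the later time `θ` with the same duration. -/
theorem IsPlan.insert_gammaTSP (hX : IsGeodesic X) (h : IsPlan x t₀ y S c k)
    (hb : IsBreak x t₀ y S c k θ z) {t : ℝ} (ht : t ≤ θ) (A : Finset (Request X)) :
    ∃ k', IsPlan x t₀ y (S ∪ A) (c + gammaTSP A z t) k' := by
  obtain ⟨k₁, h₁⟩ := exists_isPlan_gammaTSP hX A z t
  have h₂ := h₁.shift (δ := θ - t) (by linarith)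
  rw [add_sub_cancel, show t + gammaTSP A z t + (θ - t) = θ + gammaTSP A z t by ring] at h₂
  exact h.insert_loop hb h₂

theorem gammaDaRP_nonneg (hX : IsGeodesic X) (hD : 0 ≤ D) (A : Finset (Request X))
    (b : Request X) : 0 ≤ gammaDaRP D A b := by
  unfold gammaDaRP
  split_ifs
  · exact le_rfl
  · exact add_nonneg (le_min (gammaTSP_nonneg hX _ _ _) (gammaTSP_nonneg hX _ _ _)) hD

theorem gammaDaRP_of_ne {A : Finset (Request X)} {b : Request X} (h : A ≠ {b}) :
    gammaDaRP D A b = gammaTSP A b.src b.release + D ∨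
      gammaDaRP D A b = gammaTSP A b.dst (b.release + b.len) + D := by
  unfold gammaDaRP
  rw [if_neg h]
  rcases min_choice (gammaTSP A b.src b.release) (gammaTSP A b.dst (b.release + b.len)) with e | e
  · left; rw [e]
  · right; rw [e]

/-- The plan picks up `b` no earlier than its release date, so it visits both reference points of
the cost no earlier than the respective reference times. -/
theorem IsPlan.insert_gammaDaRP (hX : IsGeodesic X) (h : IsPlan x t₀ y S c k) (hD : 0 ≤ D)
    (A : Finset (Request X)) {b : Request X} (hb : b ∈ S) :
    ∃ k', IsPlan x t₀ y (S ∪ A) (c + gammaDaRP D A b) k' := by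
  by_cases hA : A = {b}
  · refine ⟨k, (h.mono ?_).le ?_⟩
    · subst hA
      simp [hb]
    · linarith [gammaDaRP_nonneg hX hD A b]
  · have hr := h.release b hb
    rcases gammaDaRP_of_ne (D := D) hA with e | e <;> rw [e]
    · obtain ⟨k', h'⟩ := h.insert_gammaTSP hX (h.isBreak_src hb) hr A
      exact ⟨k', h'.le (by linarith)⟩
    · obtain ⟨k', h'⟩ := h.insert_gammaTSP hX (h.isBreak_dst hb)
        (t := b.release + b.len) (by linarith) A
      exact ⟨k', h'.le (by linarith)⟩

theorem IsPlan.insert_cover (hX : IsGeodesic X) (h : IsPlan x t₀ y S c k) (hD : 0 ≤ D)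
    (H : Finset (Finset (Request X) × Request X)) (hH : ∀ e ∈ H, e.2 ∈ S) :
    ∃ k', IsPlan x t₀ y (S ∪ {q | ∃ e ∈ H, q ∈ e.1}) (c + ∑ e ∈ H, gammaDaRP D e.1 e.2) k' := by
  classical
  induction H using Finset.induction_on with
  | empty => exact ⟨k, by simpa using h⟩
  | insert e H he ih =>
    obtain ⟨k₁, h₁⟩ := ih fun e' he' => hH e' (Finset.mem_insert_of_mem he')
    obtain ⟨k₂, h₂⟩ := h₁.insert_gammaDaRP hX hD e.1 (b := e.2)
      (Or.inl (hH e (Finset.mem_insert_self _ _)))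
    refine ⟨k₂, (h₂.mono ?_).le ?_⟩
    · rintro q (hq | ⟨e', he', hq⟩)
      · exact Or.inl (Or.inl hq)
      · rcases Finset.mem_insert.1 he' with rfl | he'
        · exact Or.inr hq
        · exact Or.inl (Or.inr ⟨e', he', hq⟩)
    · rw [Finset.sum_insert he]; linarith

/-- Used for Ĉ ≤ C* + Γ_∞(R̂, R). -/
theorem opt_le_of_isCover (hX : IsGeodesic X) (o : X) {n : ℕ∞} {R R' : Finset (Request X)}
    (hD : 0 ≤ D) {H : Finset (Finset (Request X) × Request X)} (hH : IsCover n R' R H) :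
    opt o R' ≤ opt o R + ∑ e ∈ H, gammaDaRP D e.1 e.2 := by
  obtain ⟨k, h⟩ := exists_isPlan_opt hX o R
  obtain ⟨k', h'⟩ := h.insert_cover hX hD H fun e he => Finset.mem_coe.2 (hH.1 e he).2.2
  exact opt_le hX (h'.mono fun q hq => Or.inr (hH.2 q hq))

theorem sum_len_le_gammaTSP (hX : IsGeodesic X) (A : Finset (Request X)) (x : X) (t : ℝ) :
    ∑ q ∈ A, q.len ≤ gammaTSP A x t := by
  obtain ⟨k, h⟩ := exists_isPlan_gammaTSP hX A x t
  linarith [h.sum_len_le]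

open scoped Classical in
-- A hyperedge other than `{b}` pays for a loop that contains all its rides; a free hyperedge
-- contains only an element of `R`.
theorem sum_len_sdiff_le (hX : IsGeodesic X) {n : ℕ∞} {R R' : Finset (Request X)}
    {H : Finset (Finset (Request X) × Request X)} (hH : IsCover n R' R H) :
    ∑ w ∈ R' \ R, w.len ≤ ∑ e ∈ H, gammaDaRP 0 e.1 e.2 := by
  calc ∑ w ∈ R' \ R, w.len ≤ ∑ w ∈ H.biUnion fun e => e.1 \ R, w.len := by
        refine Finset.sum_le_sum_of_subset_of_nonneg ?_ fun q _ _ => q.len_nonneg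
        intro w hw
        rw [Finset.mem_sdiff] at hw
        obtain ⟨e, he, hwe⟩ := hH.2 w hw.1
        exact Finset.mem_biUnion.2 ⟨e, he, Finset.mem_sdiff.2 ⟨hwe, hw.2⟩⟩
    _ ≤ ∑ e ∈ H, ∑ w ∈ e.1 \ R, w.len :=
        sum_biUnion_le H (fun e => e.1 \ R) Request.len_nonneg
    _ ≤ ∑ e ∈ H, gammaDaRP 0 e.1 e.2 := by
        refine Finset.sum_le_sum fun e he => ?_
        by_cases hA : e.1 = {e.2}
        · have : e.1 \ R = ∅ := by
            rw [Finset.sdiff_eq_empty_iff_subset, hA]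
            simpa using (hH.1 e he).2.2
          rw [this, Finset.sum_empty]
          exact gammaDaRP_nonneg hX le_rfl _ _
        · have hsub : ∑ w ∈ e.1 \ R, w.len ≤ ∑ w ∈ e.1, w.len :=
            Finset.sum_le_sum_of_subset_of_nonneg Finset.sdiff_subset fun q _ _ => q.len_nonneg
          rcases gammaDaRP_of_ne (D := 0) hA with e' | e' <;> rw [e', add_zero] <;>
            exact hsub.trans (sum_len_le_gammaTSP hX _ _ _)

theorem maxCommonLen_nonneg (R R' : Finset (Request X)) : 0 ≤ maxCommonLen R R' := by
  unfold maxCommonLen; positivity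

theorem len_le_maxCommonLen {R R' : Finset (Request X)} {w : Request X} (h : w ∈ R)
    (h' : w ∈ R') : w.len ≤ maxCommonLen R R' := by
  classical
  unfold maxCommonLen Request.len
  rw [← coe_nndist, NNReal.coe_le_coe]
  exact Finset.le_sup (f := fun q : Request X => nndist q.src q.dst) (Finset.mem_inter.2 ⟨h, h'⟩)

theorem gammaDaRP_le_gammaTSP (hX : IsGeodesic X) (A : Finset (Request X)) (b : Request X) :
    gammaDaRP 0 A b ≤ gammaTSP A b.src b.release := by
  unfold gammaDaRP
  split_ifs
  · exact gammaTSP_nonneg hX _ _ _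
  · rw [add_zero]; exact min_le_left _ _

/-- This allows treating both problems with the dial-a-ride costs: if rides are trivial, the
additive term vanishes and the costs can only decrease. -/
theorem coverError_olDARP_le (hX : IsGeodesic X) {P : Problem} {n : ℕ∞}
    {R R' : Finset (Request X)} (hR : P.Admits R) :
    coverError .OlDARP n R R' ≤ coverError P n R R' := by
  classical
  cases P with
  | OlDARP => exact le_rfl
  | OlTSP =>
    have h0 : maxCommonLen R R' = 0 := by
      refine le_antisymm ?_ (maxCommonLen_nonneg _ _)
      unfold maxCommonLen
      rw [← NNReal.coe_zero, NNReal.coe_le_coe]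
      refine Finset.sup_le fun q hq => ?_
      rw [hR q (Finset.mem_inter.1 hq).1, nndist_self]
    simp only [coverError, h0]
    exact add_le_add (coverValue_mono fun _ _ _ _ => gammaDaRP_le_gammaTSP hX _ _)
      (coverValue_mono fun _ _ _ _ => gammaDaRP_le_gammaTSP hX _ _)

/-- An upper bound in terms of arbitrary covers is an upper bound in terms of the cover error. -/
theorem le_of_forall_isCover (hX : IsGeodesic X) {n : ℕ∞} {R R' : Finset (Request X)} {v : ℝ≥0∞}
    {a b : ℝ} (ha : 0 < a) (hb : 0 ≤ b)
    (h : ∀ H₁ H₂, IsCover ⊤ R' R H₁ → IsCover n R R' H₂ → v ≤ ENNReal.ofReal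
      (a * (b + 3 * (∑ e ∈ H₁, gammaDaRP 0 e.1 e.2 +
        ∑ e ∈ H₂, gammaDaRP (maxCommonLen R R') e.1 e.2)))) :
    v ≤ ENNReal.ofReal a * (ENNReal.ofReal b + 3 * coverError .OlDARP n R R') := by
  have ha' : ENNReal.ofReal a ≠ 0 := by simpa using ha
  unfold coverError
  -- With an infinite cover value the bound is trivial; otherwise `h` is applied to minimum covers.
  rcases coverValue_eq_top_or ⊤ (gammaDaRP 0) R' R with e₁ | ⟨H₁, hH₁, e₁⟩
  · simp [e₁, ENNReal.mul_top, ha']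
  rcases coverValue_eq_top_or n (gammaDaRP (maxCommonLen R R')) R R' with e₂ | ⟨H₂, hH₂, e₂⟩
  · simp [e₂, ENNReal.mul_top, ha']
  refine (h H₁ H₂ hH₁ hH₂).trans_eq ?_
  have n₁ : ∀ e ∈ H₁, 0 ≤ gammaDaRP 0 e.1 e.2 := fun e _ => gammaDaRP_nonneg hX le_rfl _ _
  have n₂ : ∀ e ∈ H₂, 0 ≤ gammaDaRP (maxCommonLen R R') e.1 e.2 :=
    fun e _ => gammaDaRP_nonneg hX (maxCommonLen_nonneg _ _) _ _
  have s₁ := Finset.sum_nonneg n₁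
  have s₂ := Finset.sum_nonneg n₂
  dsimp only
  rw [e₁, e₂, ← ENNReal.ofReal_sum_of_nonneg n₁, ← ENNReal.ofReal_sum_of_nonneg n₂,
    ENNReal.ofReal_mul ha.le, ENNReal.ofReal_add hb (by positivity),
    ENNReal.ofReal_mul (by norm_num), ENNReal.ofReal_add s₁ s₂]
  norm_num

end Covers

/-! ### Detours for unexpected requests -/

section Detours

variable {X : Type u} [MetricSpace X]
variable {x y z : X} {t₀ c e t : ℝ} {S : Set (Request X)} {k : Request X → ℝ}

theorem IsPlan.isBreak_start (h : IsPlan x t₀ y S c k) : IsBreak x t₀ y S c k t₀ x :=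
  ⟨by simp, h.start_le, fun q hq => Or.inr (h.start q hq)⟩

theorem IsPlan.insert_many (h : IsPlan x t₀ y S c k) (N : Finset (Request X))
    (f : Request X → ℝ)
    (hN : ∀ q ∈ N, ∀ S' c' k', S ⊆ S' → IsPlan x t₀ y S' c' k' →
      ∃ k'', IsPlan x t₀ y (S' ∪ {q}) (c' + f q) k'') :
    ∃ k', IsPlan x t₀ y (S ∪ N) (c + ∑ q ∈ N, f q) k' := by
  classical
  induction N using Finset.induction_on with
  | empty => exact ⟨k, by simpa using h⟩
  | insert a N ha ih =>
    obtain ⟨k₁, h₁⟩ := ih fun q hq => hN q (Finset.mem_insert_of_mem hq)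
    obtain ⟨k₂, h₂⟩ := hN a (Finset.mem_insert_self _ _) _ _ _ Set.subset_union_left h₁
    refine ⟨k₂, ?_⟩
    rw [Finset.coe_insert, Finset.sum_insert ha, Set.insert_eq, Set.union_comm {a},
      ← Set.union_assoc, add_comm (f a), ← add_assoc]
    exact h₂

/-- The first bound counts travel, the second one waiting for the release. Twice the second bound
pays for the way to a covering request that has already been served. -/
theorem le_gammaTSP_singleton (hX : IsGeodesic X) (q : Request X) (x : X) (t : ℝ) :
    dist x q.src + q.len + dist q.dst x ≤ gammaTSP {q} x t ∧
      q.release - t + q.len + dist q.dst x ≤ gammaTSP {q} x t := by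
  obtain ⟨k, h⟩ := exists_isPlan_gammaTSP hX {q} x t
  have hq : q ∈ (({q} : Finset (Request X)) : Set (Request X)) := by simp
  have h1 := h.start q hq
  have h2 := h.release q hq
  have h3 := h.finish q hq
  constructor <;> linarith

/-- New requests `N` can be added to a plan, either at a request `b` that the plan serves, or by
a detour to a point near a place `z`, which has to be visited for that purpose. -/
theorem IsPlan.insert_detours (hX : IsGeodesic X) (h : IsPlan x t₀ y S c k) (ht₀ : 0 ≤ t₀)
    (N : Finset (Request X)) (γ : Request X → ℝ) (z : X) (he : 0 ≤ e)
    (hrel : ∀ q ∈ N, q.release ≤ t₀)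
    (hN : ∀ q ∈ N, ∃ x' t', γ q = gammaTSP {q} x' t' ∧
      ((e = 0 ∧ ∃ b ∈ S, (x' = b.src ∧ t' = b.release) ∨ (x' = b.dst ∧ t' = b.release + b.len)) ∨
        2 * dist z x' + e ≤ 2 * (q.release - t') ∨ (e = 0 ∧ x' = x ∧ t' ≤ t₀))) :
    ∃ k', IsPlan x t₀ y (S ∪ N)
      (c + 2 * dist x z + ∑ q ∈ N, (3 * γ q - 2 * q.len - e)) k' := by
  -- A dummy request turns `z` into a break of the plan, at the price of one return trip from `x`.
  let w : Request X := ⟨z, z, t₀, ht₀⟩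
  have wlen : w.len = 0 := dist_self z
  have d0 := dist_nonneg (x := x) (y := z)
  obtain ⟨k₁, h₁⟩ := h.insert_loop h.isBreak_start (S' := {w}) (δ := 2 * dist x z)
    (k' := fun _ => t₀ + dist x z)
    (isPlan_singleton (by rw [dist_self]; linarith) le_rfl (by change t₀ ≤ _; linarith)
      (by rw [wlen]; change _ + dist z x ≤ _; rw [dist_comm z x]; linarith))
  obtain ⟨k₂, h₂⟩ := h₁.insert_many N (fun q => 3 * γ q - 2 * q.len - e) (by
    intro q hq S' c' k' hS' h'
    obtain ⟨x', t', hγ, hcase⟩ := hN q hq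
    have hr := hrel q hq
    obtain ⟨g1, g2⟩ := le_gammaTSP_singleton hX q x' t'
    rw [← hγ] at g1 g2
    have d1 := dist_nonneg (x := x') (y := q.src)
    have d2 := dist_nonneg (x := q.dst) (y := x')
    have l0 := q.len_nonneg
    rcases hcase with ⟨rfl, b, hb, hb'⟩ | hz | ⟨rfl, rfl, ht'⟩
    -- The loop costs `γ q`, which is within the budget since `γ q ≥ q.len`.
    · have hbS : b ∈ S' := hS' (Or.inl hb)
      have hbr := h'.release b hbS
      have : ∃ k'', IsPlan x t₀ y (S' ∪ ({q} : Finset (Request X))) (c' + γ q) k'' := by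
        rw [hγ]
        rcases hb' with ⟨rfl, rfl⟩ | ⟨rfl, rfl⟩
        · exact h'.insert_gammaTSP hX (h'.isBreak_src hbS) hbr {q}
        · exact h'.insert_gammaTSP hX (h'.isBreak_dst hbS) (by linarith) {q}
      obtain ⟨k'', h''⟩ := this
      rw [Finset.coe_singleton] at h''
      exact ⟨k'', h''.le (by linarith)⟩
    -- The loop leads from `z` via `x'` through `q` and back. By `g2`, the two trips between `z` and
    -- `x'` cost at most `2 * γ q - 2 * q.len - e`, and the rest at most `γ q`.
    · have hwS : w ∈ S' := hS' (Or.inr rfl)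
      have hw := h'.release w hwS
      change t₀ ≤ _ at hw
      have dz := dist_nonneg (x := z) (y := x')
      have hcomm := dist_comm z x'
      obtain ⟨k'', h''⟩ := h'.insert_loop (h'.isBreak_src hwS) (S' := {q})
        (δ := 3 * γ q - 2 * q.len - e) (k' := fun _ => k' w + (dist z x' + dist x' q.src))
        (isPlan_singleton (by rw [dist_self]; linarith)
          (by change _ + dist z _ ≤ _; linarith [dist_triangle z x' q.src])
          (by linarith)
          (by change _ + dist _ z ≤ _; linarith [dist_triangle q.dst x' z]))
      exact ⟨k'', h''⟩
    · obtain ⟨k'', h''⟩ := h'.insert_gammaTSP hX h'.isBreak_start ht' {q}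
      rw [← hγ, Finset.coe_singleton] at h''
      exact ⟨k'', h''.le (by linarith)⟩)
  exact ⟨k₂, h₂.mono (Set.union_subset_union_left _ Set.subset_union_left)⟩

end Detours

/-! ### Times at which the server is free -/

section Schedules

variable {X : Type u} [MetricSpace X]
variable {o : X} {σ : Schedule X} {V : Set (Request X)} {q : Request X} {s r τ : ℝ}

theorem Schedule.Feasible.nonneg (h : σ.Feasible o V) (hq : σ.pick q = some s) : 0 ≤ s :=
  q.release_nonneg.trans (h.release_le q s hq)

/-- Openness is what makes the first free time exist as a minimum. -/
theorem Schedule.isOpen_busy (σ : Schedule X) : IsOpen {t | σ.Busy t} := by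
  have : {t | σ.Busy t} = ⋃ q, ⋃ s, ⋃ (_ : σ.pick q = some s), Set.Ioo s (s + q.len) := by
    ext t
    simp only [Set.mem_iUnion, Set.mem_Ioo, exists_prop]
    rfl
  rw [this]
  exact isOpen_iUnion fun _ => isOpen_iUnion fun _ => isOpen_iUnion fun _ => isOpen_Ioo

theorem le_of_not_busy (h : ¬ σ.Busy τ) (hq : σ.pick q = some s) (hs : s < τ) :
    s + q.len ≤ τ := by
  by_contra! hlt
  exact h ⟨q, s, hq, hs, hlt⟩

theorem Schedule.Feasible.not_busy_pick (h : σ.Feasible o V) (hq : σ.pick q = some s) :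
    ¬ σ.Busy s := by
  rintro ⟨q', s', hq', h1, h2⟩
  by_cases hne : q' = q
  · subst hne
    rw [hq] at hq'
    exact absurd (Option.some.inj hq') h1.ne'
  · rcases h.capacity q' s' q s hq' hq hne with e | e
    · linarith
    · linarith [q.len_nonneg]

/-- Even consecutive rides are separated by a free moment, so an interruption of replanning lasts
for one ride only. -/
theorem Schedule.Feasible.not_busy_deliver (h : σ.Feasible o V) (hq : σ.pick q = some s) :
    ¬ σ.Busy (s + q.len) := by
  rintro ⟨q', s', hq', h1, h2⟩
  by_cases hne : q' = q
  · subst hne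
    rw [hq] at hq'
    rw [Option.some.inj hq'] at h2
    exact absurd h2 (lt_irrefl _)
  · rcases h.capacity q' s' q s hq' hq hne with e | e
    · linarith [q.len_nonneg]
    · linarith

theorem Schedule.Feasible.exists_first_free (h : σ.Feasible o V) (hV : V.Finite) (r : ℝ) :
    ∃ τ, r ≤ τ ∧ ¬ σ.Busy τ ∧ ∀ t, r ≤ t → t < τ → σ.Busy t := by
  obtain ⟨B, hB⟩ : ∃ B, ∀ q s, σ.pick q = some s → s + q.len ≤ B := by
    obtain ⟨B, hB⟩ := (hV.image fun q => (σ.pick q).getD 0 + q.len).bddAbove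
    refine ⟨B, fun q s hq => hB ⟨q, h.mem q s hq, ?_⟩⟩
    simp [hq]
  set F : Set ℝ := Set.Ici r ∩ {t | σ.Busy t}ᶜ
  have hF : IsClosed F := isClosed_Ici.inter σ.isOpen_busy.isClosed_compl
  have hne : F.Nonempty := by
    refine ⟨max r B, Set.mem_Ici.2 (le_max_left _ _), ?_⟩
    rintro ⟨q, s, hq, _, h2⟩
    exact absurd (hB q s hq) (not_le.2 ((le_max_right _ _).trans_lt h2))
  have hbdd : BddBelow F := ⟨r, fun t ht => ht.1⟩
  have hmem := hF.csInf_mem hne hbdd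
  refine ⟨sInf F, hmem.1, hmem.2, fun t hrt ht => ?_⟩
  by_contra hb
  exact absurd (csInf_le hbdd ⟨hrt, hb⟩) (not_le.2 ht)

/-- If the server is busy from time `r` up to time `τ`, then it is on one ride. -/
theorem Schedule.Feasible.exists_ride (h : σ.Feasible o V) (hr : r < τ) (hτ : ¬ σ.Busy τ)
    (hb : ∀ t, r ≤ t → t < τ → σ.Busy t) :
    ∃ w s, σ.pick w = some s ∧ s < r ∧ τ = s + w.len := by
  obtain ⟨w, s, hw, h1, h2⟩ := hb r le_rfl hr
  refine ⟨w, s, hw, h1, le_antisymm ?_ ?_⟩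
  · by_contra! hlt
    exact h.not_busy_deliver hw (hb _ h2.le hlt)
  · exact le_of_not_busy hτ hw (h1.trans hr)

end Schedules

theorem pending_finite {X : Type u} (σ : Schedule X) (Rhat R : Finset (Request X)) (τ : ℝ) :
    (pending σ Rhat R τ).Finite :=
  ((Rhat.finite_toSet).union R.finite_toSet).subset fun _ hq => hq.1.imp id And.left

/-! ### The robustness bound -/

section Runs

variable {X : Type u} [MetricSpace X]
variable {o : X} {α ρ : ℝ} {a σ : Schedule X} {Rhat R : Finset (Request X)}
  {V : Set (Request X)} {T τ c : ℝ}

theorem release_add_le_opt (hX : IsGeodesic X) {q : Request X} (hq : q ∈ R) :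
    q.release + q.len + dist q.dst o ≤ opt o R ∧
      dist o q.src + q.len + dist q.dst o ≤ opt o R := by
  obtain ⟨k, h⟩ := exists_isPlan_opt hX o R
  have h1 := h.start q hq
  have h2 := h.release q hq
  have h3 := h.finish q hq
  constructor <;> linarith

theorem IsLeast.le_of_isPlan (hX : IsGeodesic X) {x y : X} {t₀ c' : ℝ} {S S' : Set (Request X)}
    {k : Request X → ℝ} (h : IsLeast (tourTimes x t₀ y S) c) (hS : S.Finite) (hS' : S ⊆ S')
    (h' : IsPlan x t₀ y S' c' k) : c ≤ c' :=
  h.2 ((mem_tourTimes hX hS).2 ⟨k, h'.mono hS'⟩)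

theorem IsReplanTime.le (h : IsReplanTime σ Rhat R T τ) : T ≤ τ := by
  rcases h with rfl | ⟨q, _, _, h1, h2, _⟩
  · exact le_rfl
  · exact h1.le.trans h2

theorem IsReplanTime.not_busy (h : IsReplanTime σ Rhat R T τ) (hT : ¬ σ.Busy T) :
    ¬ σ.Busy τ := by
  rcases h with rfl | ⟨q, _, _, _, _, h, _⟩
  · exact hT
  · exact h

theorem finite_isReplanTime (σ : Schedule X) (Rhat R : Finset (Request X)) (T : ℝ) :
    {τ | IsReplanTime σ Rhat R T τ}.Finite := by
  have hsub : ∀ q : Request X, {τ | q.release ≤ τ ∧ ¬ σ.Busy τ ∧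
      ∀ t, q.release ≤ t → t < τ → σ.Busy t}.Subsingleton := by
    rintro q τ ⟨h1, h2, h3⟩ τ' ⟨h1', h2', h3'⟩
    rcases lt_trichotomy τ τ' with h | h | h
    · exact absurd (h3' _ h1 h) h2
    · exact h
    · exact absurd (h3 _ h1' h) h2'
  refine ((Set.finite_singleton T).union
    (R.finite_toSet.biUnion fun q _ => (hsub q).finite)).subset ?_
  rintro τ (rfl | ⟨q, hq, _, _, h⟩)
  · exact Or.inl rfl
  · exact Or.inr (Set.mem_biUnion (Finset.mem_coe.2 hq) h)

theorem exists_isReplanTime (hσ : σ.Feasible o {q | q ∈ R ∨ q ∈ Rhat}) {q : Request X}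
    (hq : q ∈ R) (hq' : q ∉ Rhat) (hT : T < q.release) :
    ∃ τ, IsReplanTime σ Rhat R T τ ∧ q.release ≤ τ ∧ ∀ t, q.release ≤ t → t < τ → σ.Busy t := by
  obtain ⟨τ, h1, h2, h3⟩ := hσ.exists_first_free
    (((R.finite_toSet).union Rhat.finite_toSet).subset fun _ hq => hq) q.release
  exact ⟨τ, Or.inr ⟨q, hq, hq', hT, h1, h2, h3⟩, h1, h3⟩

/-- After the last replanning time, the server follows a fastest tour through all requests. -/
theorem exists_last_isReplanTime (hσ : σ.Feasible o {q | q ∈ R ∨ q ∈ Rhat}) (hT₀ : 0 ≤ T)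
    (hT : ¬ σ.Busy T) (h : FollowsPredictReplan o σ Rhat R T) :
    ∃ τ c, IsReplanTime σ Rhat R T τ ∧
      IsLeast (tourTimes (σ.pos τ) τ o (pending σ Rhat R τ)) c ∧
      σ.makespan o R ≤ ENNReal.ofReal c := by
  obtain ⟨τ, hτ, hmax⟩ := Set.exists_max_image _ id (finite_isReplanTime σ Rhat R T)
    ⟨T, Or.inl rfl⟩
  change IsReplanTime σ Rhat R T τ at hτ
  have hno : ∀ τ', IsReplanTime σ Rhat R T τ' → ¬ τ < τ' := fun τ' hτ' => not_lt.2 (hmax τ' hτ')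
  obtain ⟨c, p, k, htour, hc, hpos, hpick⟩ := h τ hτ
  refine ⟨τ, c, hτ, hc, iInf₂_le c ⟨hT₀.trans (hτ.le.trans htour.start_le), ?_, ?_⟩⟩
  · rw [hpos c htour.start_le fun τ' hτ' hlt => absurd hlt (hno τ' hτ')]
    exact htour.rest c le_rfl
  · intro q hq
    by_cases hp : ∃ s, s < τ ∧ σ.pick q = some s
    · obtain ⟨s, hs, hqs⟩ := hp
      exact ⟨s, hqs, (le_of_not_busy (hτ.not_busy hT) hqs hs).trans htour.start_le⟩
    · have hqp : q ∈ pending σ Rhat R τ := by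
        refine ⟨?_, hp⟩
        by_cases hqh : q ∈ Rhat
        · exact Or.inl hqh
        · refine Or.inr ⟨hq, ?_⟩
          -- An unexpected request released after `τ` would cause another replanning.
          by_contra! hlt
          obtain ⟨τ', h1, h2, -⟩ := exists_isReplanTime hσ hq hqh (hτ.le.trans_lt hlt)
          exact hno τ' h1 (hlt.trans_le h2)
      exact ⟨k q, (hpick q _ (htour.start_le_pick q hqp) fun τ' hτ' hlt =>
        absurd hlt (hno τ' hτ')).2 ⟨hqp, rfl⟩, htour.deliver_le q hqp⟩

theorem IsAlgoGenRun.pos_eq_origin (h : IsAlgoGenRun o α a σ Rhat R)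
    (hT : 0 ≤ α * opt o Rhat) : σ.pos (α * opt o Rhat) = o := by
  by_cases hle : α * opt o Rhat + dist (a.pos (α * opt o Rhat)) o ≤ α * opt o Rhat
  · rw [h.follow _ hT hle]
    exact dist_le_zero.1 (by linarith)
  · have := h.go_home _ hT le_rfl (not_le.1 hle)
    exact dist_le_zero.1 (by linarith)

theorem IsAlgoGenRun.not_busy (h : IsAlgoGenRun o α a σ Rhat R) :
    ¬ σ.Busy (α * opt o Rhat) := by
  rintro ⟨q, s, hq, h1, h2⟩
  have := ((h.follow_pick q s h1).1 hq).2
  linarith [dist_nonneg (x := q.dst) (y := o)]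

/-- If `a` completes at a time `t < T`, it is in the origin then; by unit speed all its rides can be
followed by a timely return, so none of them is refused. -/
theorem makespan_le_of_lt (ha : a.Feasible o V) (h : IsAlgoGenRun o α a σ Rhat R)
    (hlt : a.makespan o R < ENNReal.ofReal (α * opt o Rhat)) :
    σ.makespan o R ≤ a.makespan o R := by
  refine le_of_forall_gt_imp_ge_of_dense fun v hv => ?_
  obtain ⟨t, ht⟩ := iInf_lt_iff.1 (lt_min hlt hv)
  obtain ⟨hd, ht⟩ := iInf_lt_iff.1 ht
  obtain ⟨ht₁, ht₂⟩ := lt_min_iff.1 ht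
  have htT : t < α * opt o Rhat := (ENNReal.ofReal_lt_ofReal_iff'.1 ht₁).1
  refine (iInf₂_le t ⟨hd.1, ?_, fun q hq => ?_⟩).trans ht₂.le
  · rw [h.follow t hd.1 (by rw [hd.2.1, dist_self]; linarith), hd.2.1]
  · obtain ⟨s, hs, hst⟩ := hd.2.2 q hq
    have l0 := q.len_nonneg
    have hdist := ha.speed (s + q.len) t (by linarith [ha.nonneg hs]) hst
    rw [ha.deliver q s hs, hd.2.1] at hdist
    exact ⟨s, (h.follow_pick q s (by linarith)).2 ⟨hs, by linarith⟩, hst⟩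

/-- Going home, serving all actual and then all predicted requests is an option when replanning. -/
theorem le_home_then_all (hX : IsGeodesic X)
    (hc : IsLeast (tourTimes (σ.pos τ) τ o (pending σ Rhat R τ)) c) (hτ : 0 ≤ τ) :
    c ≤ τ + dist (σ.pos τ) o + opt o R + opt o Rhat := by
  obtain ⟨k₁, h₁⟩ := exists_isPlan_opt hX o R
  obtain ⟨k₂, h₂⟩ := exists_isPlan_opt hX o Rhat
  have d0 := dist_nonneg (x := σ.pos τ) (y := o)
  have o1 := opt_nonneg hX o R
  have h₁' := h₁.shift (δ := τ + dist (σ.pos τ) o) (by linarith)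
  rw [zero_add] at h₁'
  obtain ⟨k₃, h₃⟩ := (isPlan_empty (x := σ.pos τ) (t₀ := τ) (y := o) le_rfl fun _ => 0).trans h₁'
  have h₂' := h₂.shift (δ := opt o R + (τ + dist (σ.pos τ) o)) (by linarith)
  rw [zero_add] at h₂'
  obtain ⟨k₄, h₄⟩ := h₃.trans h₂'
  have := IsLeast.le_of_isPlan hX hc (pending_finite _ _ _ _) (fun q hq => ?_) h₄
  · linarith
  · rcases hq.1 with hq | hq
    · exact Or.inr hq
    · exact Or.inl (Or.inr hq.1)

theorem IsAlgoGenRun.robust (hX : IsGeodesic X) (hα : 0 < α) (hρ : 2 ≤ ρ)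
    (ha : a.Feasible o V) (hσ : σ.Feasible o {q | q ∈ R ∨ q ∈ Rhat})
    (h : IsAlgoGenRun o α a σ Rhat R)
    (hA : a.makespan o R ≤ ENNReal.ofReal (ρ * opt o R)) :
    σ.makespan o R ≤ ENNReal.ofReal ((1 + ρ + ρ / α) * opt o R) := by
  have o1 := opt_nonneg hX o R
  have o2 := opt_nonneg hX o Rhat
  have hT₀ : 0 ≤ α * opt o Rhat := by positivity
  have hρα : 0 ≤ ρ / α * opt o R := by positivity
  rcases lt_or_ge (a.makespan o R) (ENNReal.ofReal (α * opt o Rhat)) with hlt | hge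
  · refine (makespan_le_of_lt ha h hlt).trans (hA.trans (ENNReal.ofReal_le_ofReal ?_))
    nlinarith
  · have hTρ : α * opt o Rhat ≤ ρ * opt o R :=
      (ENNReal.ofReal_le_ofReal_iff (by positivity)).1 (hge.trans hA)
    obtain ⟨τ, c, hτ, hc, hm⟩ := exists_last_isReplanTime hσ hT₀ h.not_busy h.replan
    refine hm.trans (ENNReal.ofReal_le_ofReal ?_)
    have hτ₀ : 0 ≤ τ := hT₀.trans hτ.le
    have hc' := le_home_then_all hX hc hτ₀
    rcases hτ with rfl | ⟨q, hq, -, hqT, hqτ, hfree, hbusy⟩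
    · rw [h.pos_eq_origin hT₀, dist_self] at hc'
      have : opt o Rhat ≤ ρ / α * opt o R := by
        rw [div_mul_eq_mul_div, le_div_iff₀ hα]; linarith
      linarith
    · obtain ⟨hq1, hq2⟩ := release_add_le_opt hX (o := o) hq
      have hqo : q.release ≤ opt o R := by
        linarith [q.len_nonneg, dist_nonneg (x := q.dst) (y := o)]
      -- The release after T gives αĈ < C*, and `ρ ≥ 2` absorbs the factor 2.
      have h2 : 2 * opt o Rhat ≤ ρ / α * opt o R := by
        rw [div_mul_eq_mul_div, le_div_iff₀ hα]
        nlinarith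
      -- Either the server is free at the release and has had only the time since T to move away
      -- from the origin, or it finishes a ride, which together with the way home fits into an
      -- optimal tour for R or R̂.
      have key : τ + dist (σ.pos τ) o ≤ 2 * opt o R + opt o Rhat := by
        rcases hqτ.eq_or_lt with rfl | hlt
        · have := hσ.speed _ _ hT₀ hqT.le
          rw [h.pos_eq_origin hT₀, dist_comm] at this
          linarith
        · obtain ⟨w, s, hw, hs, rfl⟩ := hσ.exists_ride hlt hfree hbusy
          rw [hσ.deliver w s hw]
          rcases hσ.mem w s hw with hwR | hwR
          · have := (release_add_le_opt hX (o := o) hwR).2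
            linarith [dist_nonneg (x := o) (y := w.src)]
          · have := (release_add_le_opt hX (o := o) hwR).2
            linarith [dist_nonneg (x := o) (y := w.src)]
      nlinarith

end Runs

/-! ### The consistency bound -/

section Consistency

variable {X : Type u} [MetricSpace X]
variable {o : X} {α D : ℝ} {a σ : Schedule X} {Rhat R : Finset (Request X)}
  {V : Set (Request X)} {T τ τ₀ c c₀ : ℝ} {γ : Request X → ℝ}

/-- A single expense `d` is covered if each of at least one requests sets `d` aside. It serves for
the waiting time and for `3 * D`. -/
theorem sum_sub_add_le {ι : Type*} {N : Finset ι} (hN : N.Nonempty) (f : ι → ℝ) {d : ℝ}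
    (hd : 0 ≤ d) : ∑ q ∈ N, (f q - d) + d ≤ ∑ q ∈ N, f q := by
  rw [Finset.sum_sub_distrib, Finset.sum_const, nsmul_eq_mul]
  have : (1 : ℝ) ≤ N.card := by exact_mod_cast hN.card_pos
  nlinarith

/-- What is needed of the cost of covering an unexpected request by one predicted request. -/
def CoversSingly (Rhat R : Finset (Request X)) (γ : Request X → ℝ) : Prop :=
  ∀ q ∈ R, q ∉ Rhat → ∃ b ∈ Rhat, γ q = gammaTSP {q} b.src b.release ∨
    γ q = gammaTSP {q} b.dst (b.release + b.len)

open scoped Classical in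
/-- The unexpected requests released up to time `τ`. -/
noncomputable def unexpected (Rhat R : Finset (Request X)) (τ : ℝ) : Finset (Request X) :=
  R.filter fun q => q ∉ Rhat ∧ q.release ≤ τ

open scoped Classical in
/-- By how much the planned completion time increases from one replanning time to the next. -/
theorem completion_le_of_next (hX : IsGeodesic X) (hσ : σ.Feasible o {q | q ∈ R ∨ q ∈ Rhat})
    (hT₀ : 0 ≤ T) (hT : ¬ σ.Busy T) (hrep : FollowsPredictReplan o σ Rhat R T)
    (hτ₀ : IsReplanTime σ Rhat R T τ₀) (hτ : IsReplanTime σ Rhat R T τ) (hlt : τ₀ < τ)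
    (hnext : ∀ τ', IsReplanTime σ Rhat R T τ' → τ₀ < τ' → τ ≤ τ')
    (hc₀ : IsLeast (tourTimes (σ.pos τ₀) τ₀ o (pending σ Rhat R τ₀)) c₀)
    (hc : IsLeast (tourTimes (σ.pos τ) τ o (pending σ Rhat R τ)) c)
    (hD₀ : 0 ≤ D) (hD : ∀ w ∈ R, w ∈ Rhat → w.len ≤ D) (hγ : CoversSingly Rhat R γ) :
    ∃ δ, c ≤ c₀ + ∑ q ∈ unexpected Rhat R τ \ unexpected Rhat R τ₀,
        (3 * (γ q + D) - 2 * q.len) + δ ∧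
      (δ = 0 ∨ ∃ w s, σ.pick w = some s ∧ τ₀ ≤ s ∧ s < τ ∧ ¬ (w ∈ R ∧ w ∈ Rhat) ∧
        δ = 2 * w.len) := by
  obtain ⟨c', p, k, htour, hc', hpos, hpick⟩ := hrep τ₀ hτ₀
  obtain rfl : c' = c₀ := hc'.unique hc₀
  replace hpos : ∀ t, τ₀ ≤ t → t ≤ τ → σ.pos t = p t := fun t h1 h2 =>
    hpos t h1 fun τ' h3 h4 => h2.trans (hnext τ' h3 h4)
  replace hpick : ∀ q s, τ₀ ≤ s → s < τ →
      (σ.pick q = some s ↔ q ∈ pending σ Rhat R τ₀ ∧ k q = s) := fun q s h1 h2 =>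
    hpick q s h1 fun τ' h3 h4 => h2.trans_le (hnext τ' h3 h4)
  have nb₀ := hτ₀.not_busy hT
  have nb := hτ.not_busy hT
  have hτ₀₀ : 0 ≤ τ₀ := hT₀.trans hτ₀.le
  have hcs := htour.start_le
  set S₁ : Set (Request X) := {q | q ∈ pending σ Rhat R τ₀ ∧ τ ≤ k q} with hS₁
  have mS₁ : ∀ q, q ∈ S₁ ↔ q ∈ pending σ Rhat R τ₀ ∧ τ ≤ k q := fun q => Iff.rfl
  set N := unexpected Rhat R τ \ unexpected Rhat R τ₀ with hN
  have mN : ∀ q, q ∈ N ↔ q ∈ R ∧ q ∉ Rhat ∧ τ₀ < q.release ∧ q.release ≤ τ := by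
    intro q
    simp only [hN, unexpected, Finset.mem_sdiff, Finset.mem_filter, not_and, not_le]
    tauto
  have hτpos : σ.pos τ = p τ := hpos τ hlt.le le_rfl
  -- The remainder of the previous tour. If that tour ended before `τ`, the server has been waiting
  -- in the origin, hence the maximum.
  have hplan : IsPlan (σ.pos τ) τ o S₁ (max c' τ) k := by
    refine IsTour.isPlan (p := p) ⟨le_max_right _ _, hτpos.symm,
      fun t ht => htour.rest t ((le_max_left _ _).trans ht),
      fun s t hs => htour.speed s t (hlt.le.trans hs), fun q hq => hq.2,
      fun q hq => htour.release_le q hq.1, fun q hq => htour.pick_up q hq.1,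
      fun q hq => htour.deliver q hq.1,
      fun q hq => (htour.deliver_le q hq.1).trans (le_max_left _ _),
      fun q hq q' hq' => htour.capacity q hq.1 q' hq'.1⟩
  have hunpicked : ∀ q, q ∈ Rhat ∨ (q ∈ R ∧ q.release ≤ τ₀) →
      (¬ ∃ s, s < τ ∧ σ.pick q = some s) → q ∈ S₁ := by
    intro q hq hp
    have hq' : q ∈ pending σ Rhat R τ₀ := ⟨hq, fun ⟨s, hs, h⟩ => hp ⟨s, hs.trans hlt, h⟩⟩
    refine ⟨hq', ?_⟩
    by_contra! hk
    exact hp ⟨k q, hk, (hpick q _ (htour.start_le_pick q hq') hk).2 ⟨hq', rfl⟩⟩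
  have hsub : pending σ Rhat R τ ⊆ S₁ ∪ (N : Set (Request X)) := by
    rintro q ⟨hq, hp⟩
    by_cases hq' : q ∈ Rhat ∨ (q ∈ R ∧ q.release ≤ τ₀)
    · exact Or.inl (hunpicked q hq' hp)
    · push Not at hq'
      obtain ⟨h1, h2⟩ := hq.resolve_left hq'.1
      exact Or.inr (Finset.mem_coe.2 ((mN q).2 ⟨h1, hq'.1, hq'.2 h1, h2⟩))
  -- A free moment between the release and `τ` would have been an earlier replanning time.
  have hNbusy : ∀ q ∈ N, ∀ t, q.release ≤ t → t < τ → σ.Busy t := by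
    intro q hq t h1 h2
    obtain ⟨g1, g2, g3, g4⟩ := (mN q).1 hq
    obtain ⟨τ', e1, e2, e3⟩ := exists_isReplanTime hσ g1 g2 (hτ₀.le.trans_lt g3)
    exact e3 t h1 (h2.trans_le (hnext τ' e1 (g3.trans_le e2)))
  have hNne : N.Nonempty := by
    rcases hτ with rfl | ⟨q, h1, h2, h3, h4, -, h5⟩
    · exact absurd hτ₀.le (not_le.2 hlt)
    · refine ⟨q, (mN q).2 ⟨h1, h2, ?_, h4⟩⟩
      by_contra! hle
      exact nb₀ (h5 τ₀ hle hlt)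
  have hdone : ∀ b s, σ.pick b = some s → s < τ → s + b.len ≤ τ ∧ s + b.len ≤ c' := by
    intro b s hb hs
    refine ⟨le_of_not_busy nb hb hs, ?_⟩
    rcases lt_or_ge s τ₀ with h | h
    · exact (le_of_not_busy nb₀ hb h).trans hcs
    · obtain ⟨h1, h2⟩ := (hpick b s h hs).1 hb
      rw [← h2]
      exact htour.deliver_le b h1
  have hrelN : ∀ q ∈ N, q.release ≤ τ := fun q hq => ((mN q).1 hq).2.2.2
  have hτ0 : 0 ≤ τ := hτ₀₀.trans hlt.le
  by_cases hride : ∃ q ∈ N, q.release < τ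
  · obtain ⟨q₁, hq₁, hq₁τ⟩ := hride
    obtain ⟨w, s, hw, hs, hτs⟩ := hσ.exists_ride hq₁τ nb (hNbusy q₁ hq₁)
    have hsτ : s < τ := hs.trans hq₁τ
    have hs₀ : τ₀ ≤ s := by
      by_contra! h
      linarith [le_of_not_busy nb₀ hw h]
    have hcτ : τ ≤ c' := hτs ▸ (hdone w s hw hsτ).2
    rw [max_eq_left hcτ] at hplan
    have hspos := hσ.pick_up w s hw
    have hwdst : σ.pos τ = w.dst := hτs ▸ hσ.deliver w s hw
    -- The server is free when it picks up `w`, so no new request was released before that.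
    have hsN : ∀ q ∈ N, s ≤ q.release := by
      intro q hq
      by_contra! h
      exact hσ.not_busy_pick hw (hNbusy q hq s h.le hsτ)
    -- Detours are measured from `w.src`: the server was there no later than the new requests were
    -- released, so the elapsed time bounds the way to places visited before. For `w.dst` this
    -- fails.
    obtain ⟨k', hk'⟩ := hplan.insert_detours hX hτ0 N γ w.src le_rfl hrelN (by
      intro q hq
      obtain ⟨g1, g2, g3, g4⟩ := (mN q).1 hq
      have hsq := hsN q hq
      obtain ⟨b, hb, hγb⟩ := hγ q g1 g2
      by_cases hp : ∃ s, s < τ ∧ σ.pick b = some s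
      · obtain ⟨s', hs', hbs'⟩ := hp
        have hrb := hσ.release_le b s' hbs'
        obtain ⟨e1, -⟩ := hdone b s' hbs' hs'
        by_cases hbw : b = w
        · subst hbw
          rw [hw] at hbs'
          obtain rfl := Option.some.inj hbs'
          rcases hγb with e | e
          · refine ⟨_, _, e, Or.inr (Or.inl ?_)⟩
            rw [dist_self]; linarith
          · exact ⟨_, _, e, Or.inr (Or.inr ⟨rfl, hwdst.symm, by linarith⟩)⟩
        · have l0 := b.len_nonneg
          have hbs : s' + b.len ≤ s := by
            rcases hσ.capacity b s' w s hbs' hw hbw with e | e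
            · exact e
            · linarith
          have s'0 := hσ.nonneg hbs'
          rcases hγb with e | e
          · refine ⟨_, _, e, Or.inr (Or.inl ?_)⟩
            have := hσ.speed s' s s'0 (by linarith)
            rw [hσ.pick_up b s' hbs', hspos, dist_comm] at this
            linarith
          · refine ⟨_, _, e, Or.inr (Or.inl ?_)⟩
            have := hσ.speed (s' + b.len) s (by linarith) hbs
            rw [hσ.deliver b s' hbs', hspos, dist_comm] at this
            linarith
      · have hbS := hunpicked b (Or.inl hb) hp
        rcases hγb with e | e
        · exact ⟨_, _, e, Or.inl ⟨rfl, b, hbS, Or.inl ⟨rfl, rfl⟩⟩⟩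
        · exact ⟨_, _, e, Or.inl ⟨rfl, b, hbS, Or.inr ⟨rfl, rfl⟩⟩⟩)
    have hcle := IsLeast.le_of_isPlan hX hc (pending_finite _ _ _ _) hsub hk'
    have hwl : dist (σ.pos τ) w.src = w.len := by rw [hwdst, dist_comm]; rfl
    -- One new request leaves `3 * D`, enough for the `2 * w.len` of a ride that is both actual and
    -- predicted.
    have hsum := sum_sub_add_le hNne (fun q => 3 * (γ q + D) - 2 * q.len) (d := 3 * D)
      (by positivity)
    have hcongr : ∑ q ∈ N, (3 * γ q - 2 * q.len - 0) =
        ∑ q ∈ N, (3 * (γ q + D) - 2 * q.len - 3 * D) :=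
      Finset.sum_congr rfl fun q _ => by ring
    rw [hwl, hcongr] at hcle
    by_cases hwRR : w ∈ R ∧ w ∈ Rhat
    · have := hD w hwRR.1 hwRR.2
      exact ⟨0, by linarith, Or.inl rfl⟩
    · exact ⟨2 * w.len, by linarith, Or.inr ⟨w, s, hw, hs₀, hsτ, hwRR, rfl⟩⟩
  · push Not at hride
    have hNτ : ∀ q ∈ N, q.release = τ := fun q hq => le_antisymm (hrelN q hq) (hride q hq)
    have hmm := min_add_max c' τ
    have hm1 := min_le_left c' τ
    have hm2 := min_le_right c' τ
    have hm3 : τ₀ ≤ min c' τ := le_min hcs hlt.le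
    -- All earlier pick-ups were delivered by time `min c' τ`, and the server has not moved since.
    -- The distance bounds therefore do not include the waiting time `max c' τ - c'`.
    have hposm : σ.pos τ = σ.pos (min c' τ) := by
      rcases le_total c' τ with h | h
      · rw [min_eq_left h, hτpos, hpos c' hcs h, htour.rest τ h, htour.rest c' le_rfl]
      · rw [min_eq_right h]
    have he : 0 ≤ max c' τ - c' := sub_nonneg.2 (le_max_left _ _)
    obtain ⟨k', hk'⟩ := hplan.insert_detours hX hτ0 N γ (σ.pos τ) he hrelN (by
      intro q hq
      obtain ⟨g1, g2, g3, g4⟩ := (mN q).1 hq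
      have hqτ := hNτ q hq
      obtain ⟨b, hb, hγb⟩ := hγ q g1 g2
      have l0 := b.len_nonneg
      by_cases hp : ∃ s, s < τ ∧ σ.pick b = some s
      · obtain ⟨s', hs', hbs'⟩ := hp
        have hrb := hσ.release_le b s' hbs'
        obtain ⟨e1, e2⟩ := hdone b s' hbs' hs'
        have s'0 := hσ.nonneg hbs'
        have e3 : s' + b.len ≤ min c' τ := le_min e2 e1
        rcases hγb with e | e
        · refine ⟨_, _, e, Or.inr (Or.inl ?_)⟩
          have := hσ.speed s' (min c' τ) s'0 (by linarith)
          rw [hσ.pick_up b s' hbs', ← hposm, dist_comm] at this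
          linarith
        · refine ⟨_, _, e, Or.inr (Or.inl ?_)⟩
          have := hσ.speed (s' + b.len) (min c' τ) (by linarith) e3
          rw [hσ.deliver b s' hbs', ← hposm, dist_comm] at this
          linarith
      · have hbS := hunpicked b (Or.inl hb) hp
        -- As `b` has yet to be picked up, the previous tour is not over and there was no waiting.
        have hz : max c' τ - c' = 0 := by
          have := hbS.2
          have := htour.deliver_le b hbS.1
          rw [max_eq_left (by linarith), sub_self]
        rcases hγb with e | e
        · exact ⟨_, _, e, Or.inl ⟨hz, b, hbS, Or.inl ⟨rfl, rfl⟩⟩⟩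
        · exact ⟨_, _, e, Or.inl ⟨hz, b, hbS, Or.inr ⟨rfl, rfl⟩⟩⟩)
    have hcle := IsLeast.le_of_isPlan hX hc (pending_finite _ _ _ _) hsub hk'
    rw [dist_self] at hcle
    have hsum := sum_sub_add_le hNne (fun q => 3 * γ q - 2 * q.len) he
    have hmono : ∑ q ∈ N, (3 * γ q - 2 * q.len) ≤ ∑ q ∈ N, (3 * (γ q + D) - 2 * q.len) :=
      Finset.sum_le_sum fun q _ => by linarith
    exact ⟨0, by linarith, Or.inl rfl⟩

open scoped Classical in
/-- The requests that are not both actual and predicted, and are picked up before time `τ`. -/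
noncomputable def oneSidedPicked (σ : Schedule X) (Rhat R : Finset (Request X)) (τ : ℝ) :
    Finset (Request X) :=
  (R ∪ Rhat).filter fun w => ¬ (w ∈ R ∧ w ∈ Rhat) ∧ ∃ s, s < τ ∧ σ.pick w = some s

/-- The increments between replanning times are summed up, in the form of a minimal counterexample.
-/
theorem completion_le (hX : IsGeodesic X) (hσ : σ.Feasible o {q | q ∈ R ∨ q ∈ Rhat})
    (hT₀ : 0 ≤ T) (hT : ¬ σ.Busy T) (hTo : σ.pos T = o)
    (hrep : FollowsPredictReplan o σ Rhat R T)
    (hD₀ : 0 ≤ D) (hD : ∀ w ∈ R, w ∈ Rhat → w.len ≤ D) (hγ : CoversSingly Rhat R γ)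
    (hτ : IsReplanTime σ Rhat R T τ)
    (hc : IsLeast (tourTimes (σ.pos τ) τ o (pending σ Rhat R τ)) c) :
    c ≤ T + opt o Rhat + ∑ q ∈ unexpected Rhat R τ, (3 * (γ q + D) - 2 * q.len) +
      ∑ w ∈ oneSidedPicked σ Rhat R τ, 2 * w.len := by
  classical
  by_contra hcon
  obtain ⟨τ, ⟨hτ, hbad⟩, hmin⟩ := Set.exists_min_image
    {τ | IsReplanTime σ Rhat R T τ ∧ ∃ c, IsLeast (tourTimes (σ.pos τ) τ o
      (pending σ Rhat R τ)) c ∧ ¬ c ≤ T + opt o Rhat +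
        ∑ q ∈ unexpected Rhat R τ, (3 * (γ q + D) - 2 * q.len) +
        ∑ w ∈ oneSidedPicked σ Rhat R τ, 2 * w.len} id
    ((finite_isReplanTime σ Rhat R T).subset fun τ hτ => hτ.1) ⟨τ, hτ, c, hc, hcon⟩
  obtain ⟨c, hc, hbad⟩ := hbad
  refine hbad ?_
  have l0 : ∀ s : Finset (Request X), 0 ≤ ∑ w ∈ s, 2 * w.len := fun s =>
    Finset.sum_nonneg fun w _ => by linarith [w.len_nonneg]
  rcases hτ.le.eq_or_lt with rfl | hlt
  -- At time `T` the optimal predicted tour, delayed by `T`, still contains every covering request,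
  -- so no detours are needed.
  · obtain ⟨k, hk⟩ := exists_isPlan_opt hX o Rhat
    have hk' := hk.shift hT₀
    rw [zero_add] at hk'
    obtain ⟨k', hk'⟩ := hk'.insert_detours hX hT₀ (unexpected Rhat R T) γ o le_rfl (e := 0)
      (fun q hq => (Finset.mem_filter.1 hq).2.2) (by
        intro q hq
        obtain ⟨h1, h2, -⟩ := Finset.mem_filter.1 hq
        obtain ⟨b, hb, e | e⟩ := hγ q h1 h2
        · exact ⟨_, _, e, Or.inl ⟨rfl, b, Finset.mem_coe.2 hb, Or.inl ⟨rfl, rfl⟩⟩⟩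
        · exact ⟨_, _, e, Or.inl ⟨rfl, b, Finset.mem_coe.2 hb, Or.inr ⟨rfl, rfl⟩⟩⟩)
    rw [dist_self] at hk'
    rw [hTo] at hc
    have hcle := IsLeast.le_of_isPlan hX hc (pending_finite _ _ _ _) (by
      rintro q ⟨hq, -⟩
      by_cases hqh : q ∈ Rhat
      · exact Or.inl hqh
      · exact Or.inr (Finset.mem_coe.2 (Finset.mem_filter.2
          ⟨(hq.resolve_left hqh).1, hqh, (hq.resolve_left hqh).2⟩))) hk'
    have hmono : ∑ q ∈ unexpected Rhat R T, (3 * γ q - 2 * q.len - 0) ≤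
        ∑ q ∈ unexpected Rhat R T, (3 * (γ q + D) - 2 * q.len) :=
      Finset.sum_le_sum fun q _ => by linarith
    linarith [l0 (oneSidedPicked σ Rhat R T)]
  · obtain ⟨τ₀, ⟨hτ₀, hlt₀⟩, hmax⟩ := Set.exists_max_image
      {τ' | IsReplanTime σ Rhat R T τ' ∧ τ' < τ} id
      ((finite_isReplanTime σ Rhat R T).subset fun τ hτ => hτ.1) ⟨T, Or.inl rfl, hlt⟩
    obtain ⟨c₀, hc₀⟩ := exists_isLeast_tourTimes hX (pending_finite σ Rhat R τ₀) (σ.pos τ₀) τ₀ o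
    have hgood : c₀ ≤ T + opt o Rhat +
        ∑ q ∈ unexpected Rhat R τ₀, (3 * (γ q + D) - 2 * q.len) +
        ∑ w ∈ oneSidedPicked σ Rhat R τ₀, 2 * w.len := by
      by_contra hbad₀
      exact absurd (hmin τ₀ ⟨hτ₀, c₀, hc₀, hbad₀⟩) (not_le.2 hlt₀)
    obtain ⟨δ, hcδ, hδ⟩ := completion_le_of_next hX hσ hT₀ hT hrep hτ₀ hτ hlt₀
      (fun τ' h1 h2 => by
        by_contra! h3
        exact absurd (hmax τ' ⟨h1, h3⟩) (not_le.2 h2)) hc₀ hc hD₀ hD hγ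
    have hU : unexpected Rhat R τ₀ ⊆ unexpected Rhat R τ := by
      intro q hq
      obtain ⟨h1, h2, h3⟩ := Finset.mem_filter.1 hq
      exact Finset.mem_filter.2 ⟨h1, h2, h3.trans hlt₀.le⟩
    have hUsum := Finset.sum_sdiff hU (f := fun q => 3 * (γ q + D) - 2 * q.len)
    have hP : oneSidedPicked σ Rhat R τ₀ ⊆ oneSidedPicked σ Rhat R τ := by
      intro q hq
      obtain ⟨h1, h2, s, h3, h4⟩ := Finset.mem_filter.1 hq
      exact Finset.mem_filter.2 ⟨h1, h2, s, h3.trans hlt₀, h4⟩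
    have hPsum : ∑ w ∈ oneSidedPicked σ Rhat R τ₀, 2 * w.len + δ ≤
        ∑ w ∈ oneSidedPicked σ Rhat R τ, 2 * w.len := by
      rw [← Finset.sum_sdiff hP, add_comm]
      refine add_le_add ?_ le_rfl
      -- The ride charged now was picked up at `τ₀` or later, so it has not been charged before.
      rcases hδ with rfl | ⟨w, s, hw, hs₀, hs, hwRR, rfl⟩
      · exact l0 _
      · refine Finset.single_le_sum (f := fun w : Request X => 2 * w.len)
          (fun q _ => by linarith [q.len_nonneg]) (Finset.mem_sdiff.2 ⟨?_, ?_⟩)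
        · exact Finset.mem_filter.2 ⟨Finset.mem_union.2 (hσ.mem w s hw), hwRR, s, hs, hw⟩
        · intro hmem
          obtain ⟨-, -, s', hs', hw'⟩ := Finset.mem_filter.1 hmem
          rw [hw] at hw'
          exact absurd (Option.some.inj hw' ▸ hs') (not_lt.2 hs₀)
    linarith

open scoped Classical in
-- Charged rides in `R \ Rhat` are paid by the `2 * q.len` saved when they were inserted as
-- unexpected requests. Only predicted requests that never appear remain to be charged.
theorem IsAlgoGenRun.makespan_le (hX : IsGeodesic X) (hα : 0 < α)
    (hσ : σ.Feasible o {q | q ∈ R ∨ q ∈ Rhat}) (h : IsAlgoGenRun o α a σ Rhat R)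
    (hD₀ : 0 ≤ D) (hD : ∀ w ∈ R, w ∈ Rhat → w.len ≤ D) (hγ : CoversSingly Rhat R γ) :
    σ.makespan o R ≤ ENNReal.ofReal ((1 + α) * opt o Rhat + 3 * ∑ q ∈ R \ Rhat, (γ q + D) +
      2 * ∑ w ∈ Rhat \ R, w.len) := by
  have o2 := opt_nonneg hX o Rhat
  have hT₀ : 0 ≤ α * opt o Rhat := by positivity
  have hTo := h.pos_eq_origin hT₀
  obtain ⟨τ, c, hτ, hc, hm⟩ := exists_last_isReplanTime hσ hT₀ h.not_busy h.replan
  refine hm.trans (ENNReal.ofReal_le_ofReal ?_)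
  have key := completion_le hX hσ hT₀ h.not_busy hTo h.replan hD₀ hD hγ hτ hc
  have hγ0 : ∀ q ∈ R \ Rhat, 0 ≤ γ q + D := by
    intro q hq
    obtain ⟨h1, h2⟩ := Finset.mem_sdiff.1 hq
    obtain ⟨b, -, e | e⟩ := hγ q h1 h2 <;> rw [e] <;>
      exact add_nonneg (gammaTSP_nonneg hX _ _ _) hD₀
  have hUsub : unexpected Rhat R τ ⊆ R \ Rhat := fun q hq => by
    obtain ⟨h1, h2, -⟩ := Finset.mem_filter.1 hq
    exact Finset.mem_sdiff.2 ⟨h1, h2⟩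
  have hP : ∑ w ∈ oneSidedPicked σ Rhat R τ, 2 * w.len ≤
      ∑ w ∈ unexpected Rhat R τ, 2 * w.len + ∑ w ∈ Rhat \ R, 2 * w.len := by
    rw [← Finset.sum_union]
    · refine Finset.sum_le_sum_of_subset_of_nonneg (fun w hw => ?_) fun q _ _ => by
        linarith [q.len_nonneg]
      obtain ⟨h1, h2, s, h3, h4⟩ := Finset.mem_filter.1 hw
      by_cases hwR : w ∈ R
      · exact Finset.mem_union_left _ (Finset.mem_filter.2 ⟨hwR, fun hw' => h2 ⟨hwR, hw'⟩,
          (hσ.release_le w s h4).trans h3.le⟩)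
      · exact Finset.mem_union_right _ (Finset.mem_sdiff.2
          ⟨(Finset.mem_union.1 h1).resolve_left hwR, hwR⟩)
    · rw [Finset.disjoint_left]
      intro w hw hw'
      exact (Finset.mem_sdiff.1 hw').2 (Finset.mem_filter.1 hw).1
  have hsum : ∑ q ∈ unexpected Rhat R τ, (3 * (γ q + D) - 2 * q.len) +
      ∑ w ∈ unexpected Rhat R τ, 2 * w.len = 3 * ∑ q ∈ unexpected Rhat R τ, (γ q + D) := by
    rw [← Finset.sum_add_distrib, Finset.mul_sum]
    exact Finset.sum_congr rfl fun q _ => by ring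
  have hle : ∑ q ∈ unexpected Rhat R τ, (γ q + D) ≤ ∑ q ∈ R \ Rhat, (γ q + D) :=
    Finset.sum_le_sum_of_subset_of_nonneg hUsub fun q hq _ => hγ0 q hq
  simp only [← Finset.mul_sum] at key hP hsum
  linarith

theorem IsAlgoGenRun.consistent (hX : IsGeodesic X) (hα : 0 < α)
    (hσ : σ.Feasible o {q | q ∈ R ∨ q ∈ Rhat}) (h : IsAlgoGenRun o α a σ Rhat R) :
    σ.makespan o R ≤ ENNReal.ofReal (1 + α) *
      (ENNReal.ofReal (opt o R) + 3 * coverError .OlDARP 1 R Rhat) := by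
  classical
  refine le_of_forall_isCover hX (by linarith) (opt_nonneg hX o R) fun H₁ H₂ hH₁ hH₂ => ?_
  set D := maxCommonLen R Rhat with hDdef
  have hD₀ : 0 ≤ D := maxCommonLen_nonneg _ _
  -- Since k = 1, a hyperedge containing `q` is `{q}`, so distinct requests use distinct hyperedges.
  have hedge : ∀ q, ∃ e, q ∈ R → q ∉ Rhat → e ∈ H₂ ∧ e.1 = {q} := by
    intro q
    by_cases hq : q ∈ R
    · obtain ⟨e, he, hqe⟩ := hH₂.2 q hq
      refine ⟨e, fun _ _ => ⟨he, Finset.eq_singleton_iff_unique_mem.2 ⟨hqe, fun q' hq' => ?_⟩⟩⟩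
      exact Finset.card_le_one.1 (by exact_mod_cast (hH₂.1 e he).2.1) q' hq' q hqe
    · exact ⟨(∅, q), fun h => absurd h hq⟩
  choose f hf using hedge
  -- The covering request is predicted and `q` is not, so the free case is excluded and `D` can be
  -- split off.
  have hne : ∀ q ∈ R, q ∉ Rhat → (f q).1 ≠ {(f q).2} := by
    intro q hq hqh heq
    obtain ⟨h1, h2⟩ := hf q hq hqh
    rw [h2, Finset.singleton_inj] at heq
    exact hqh (heq ▸ (hH₂.1 _ h1).2.2)
  have hγ : CoversSingly Rhat R fun q => gammaDaRP D (f q).1 (f q).2 - D := by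
    intro q hq hqh
    obtain ⟨h1, h2⟩ := hf q hq hqh
    refine ⟨(f q).2, (hH₂.1 _ h1).2.2, ?_⟩
    rcases gammaDaRP_of_ne (D := D) (hne q hq hqh) with e | e
    · left; dsimp only; rw [e, h2]; ring
    · right; dsimp only; rw [e, h2]; ring
  have key := h.makespan_le hX hα hσ hD₀ (fun w => len_le_maxCommonLen) hγ
  refine key.trans (ENNReal.ofReal_le_ofReal ?_)
  have h1 := opt_le_of_isCover hX o le_rfl hH₁
  have h2 := sum_len_sdiff_le hX hH₁
  have h3 : ∑ q ∈ R \ Rhat, (gammaDaRP D (f q).1 (f q).2 - D + D) ≤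
      ∑ e ∈ H₂, gammaDaRP D e.1 e.2 := by
    have hinj : Set.InjOn f (R \ Rhat : Finset (Request X)) := by
      intro q hq q' hq' heq
      rw [Finset.mem_coe, Finset.mem_sdiff] at hq hq'
      have e1 := (hf q hq.1 hq.2).2
      rw [heq, (hf q' hq'.1 hq'.2).2, Finset.singleton_inj] at e1
      exact e1.symm
    simp only [sub_add_cancel]
    rw [← Finset.sum_image (f := fun e => gammaDaRP D e.1 e.2) hinj]
    refine Finset.sum_le_sum_of_subset_of_nonneg ?_ fun e _ _ => gammaDaRP_nonneg hX hD₀ _ _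
    intro e he
    obtain ⟨q, hq, rfl⟩ := Finset.mem_image.1 he
    obtain ⟨h1, h2⟩ := Finset.mem_sdiff.1 hq
    exact (hf q h1 h2).1
  have n1 : 0 ≤ ∑ e ∈ H₁, gammaDaRP 0 e.1 e.2 :=
    Finset.sum_nonneg fun e _ => gammaDaRP_nonneg hX le_rfl _ _
  have n2 : 0 ≤ ∑ e ∈ H₂, gammaDaRP D e.1 e.2 :=
    Finset.sum_nonneg fun e _ => gammaDaRP_nonneg hX hD₀ _ _
  -- The first cover cost enters with 1 + α through Ĉ and with 2 through the ride lengths, the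
  -- second with 3; neither exceeds 3(1 + α).
  nlinarith [mul_nonneg hα.le n1, mul_nonneg hα.le n2]

end Consistency

/-! ### Schedules with the same past -/

section Agreement

variable {X : Type u}

/-- The two schedules do the same up to time `t`. -/
def AgreeUpTo (t : ℝ) (σ σ' : Schedule X) : Prop :=
  (∀ s, 0 ≤ s → s ≤ t → σ.pos s = σ'.pos s) ∧
    ∀ q s, s ≤ t → (σ.pick q = some s ↔ σ'.pick q = some s)

theorem AgreeUpTo.symm {t : ℝ} {σ σ' : Schedule X} (h : AgreeUpTo t σ σ') : AgreeUpTo t σ' σ :=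
  ⟨fun s h0 hs => (h.1 s h0 hs).symm, fun q s hs => (h.2 q s hs).symm⟩

theorem AgreeUpTo.trans {t : ℝ} {σ σ' σ'' : Schedule X} (h : AgreeUpTo t σ σ')
    (h' : AgreeUpTo t σ' σ'') : AgreeUpTo t σ σ'' :=
  ⟨fun s h0 hs => (h.1 s h0 hs).trans (h'.1 s h0 hs),
    fun q s hs => (h.2 q s hs).trans (h'.2 q s hs)⟩

theorem pending_congr {σ σ' : Schedule X} {Rhat R R' : Finset (Request X)} {τ : ℝ}
    (h : ∀ q s, s < τ → (σ.pick q = some s ↔ σ'.pick q = some s))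
    (hR : ∀ q, q ∉ Rhat → q.release ≤ τ → (q ∈ R ↔ q ∈ R')) :
    pending σ Rhat R τ = pending σ' Rhat R' τ := by
  ext q
  have h1 : (∃ s, s < τ ∧ σ.pick q = some s) ↔ ∃ s, s < τ ∧ σ'.pick q = some s :=
    exists_congr fun s => and_congr_right fun hs => h q s hs
  have h2 : (q ∈ Rhat ∨ (q ∈ R ∧ q.release ≤ τ)) ↔ (q ∈ Rhat ∨ (q ∈ R' ∧ q.release ≤ τ)) := by
    by_cases hq : q ∈ Rhat
    · simp [hq]
    · have := hR q hq
      tauto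
  exact and_congr h2 (not_congr h1)

end Agreement

/-! ### Realizing the three phases -/

section Construction

variable {X : Type u} [MetricSpace X]

theorem busy_congr {σ σ' : Schedule X} {t τ : ℝ} (ht : t ≤ τ)
    (h : ∀ q s, s < τ → (σ.pick q = some s ↔ σ'.pick q = some s)) : σ.Busy t ↔ σ'.Busy t := by
  refine exists_congr fun q => exists_congr fun s => ?_
  constructor
  · rintro ⟨h1, h2, h3⟩
    exact ⟨(h q s (h2.trans_le ht)).1 h1, h2, h3⟩
  · rintro ⟨h1, h2, h3⟩
    exact ⟨(h q s (h2.trans_le ht)).2 h1, h2, h3⟩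

/-- A choice of a fastest tour. -/
noncomputable def fastestTour (x : X) (τ : ℝ) (y : X) (S : Set (Request X)) :
    (ℝ → X) × (Request X → ℝ) :=
  @Classical.epsilon _ ⟨(fun _ => x, fun _ => 0)⟩ fun v =>
    ∃ c, IsTour x τ y S c v.1 v.2 ∧ IsLeast (tourTimes x τ y S) c

/-- The choice depends on position, time, target and pending set only; this makes the construction
causal. -/
theorem fastestTour_spec (hX : IsGeodesic X) (x : X) (τ : ℝ) (y : X) {S : Set (Request X)}
    (hS : S.Finite) : ∃ c, IsTour x τ y S c (fastestTour x τ y S).1 (fastestTour x τ y S).2 ∧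
      IsLeast (tourTimes x τ y S) c := by
  obtain ⟨c, hc⟩ := exists_isLeast_tourTimes hX hS x τ y
  obtain ⟨p, k, h⟩ := hc.1
  exact Classical.epsilon_spec (p := fun v : (ℝ → X) × (Request X → ℝ) =>
    ∃ c, IsTour x τ y S c v.1 v.2 ∧ IsLeast (tourTimes x τ y S) c) ⟨(p, k), c, h, hc⟩

open scoped Classical in
/-- Follow `σ` up to time `τ`, and then a fastest tour through all pending requests. -/
noncomputable def splice (o : X) (Rhat R : Finset (Request X)) (σ : Schedule X) (τ : ℝ) :
    Schedule X where
  pos t := if t ≤ τ then σ.pos t else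
    (fastestTour (σ.pos τ) τ o (pending σ Rhat R τ)).1 t
  pick q := if ∃ s, s < τ ∧ σ.pick q = some s then σ.pick q else
    if q ∈ pending σ Rhat R τ then
      some ((fastestTour (σ.pos τ) τ o (pending σ Rhat R τ)).2 q) else none

variable {o : X} {Rhat R : Finset (Request X)} {σ : Schedule X} {τ t : ℝ} {V : Set (Request X)}

theorem splice_pos (ht : t ≤ τ) : (splice o Rhat R σ τ).pos t = σ.pos t := if_pos ht

theorem splice_pick_iff {q : Request X} {s : ℝ} :
    (splice o Rhat R σ τ).pick q = some s ↔ (s < τ ∧ σ.pick q = some s) ∨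
      (q ∈ pending σ Rhat R τ ∧
        (fastestTour (σ.pos τ) τ o (pending σ Rhat R τ)).2 q = s) := by
  classical
  unfold splice
  dsimp only
  by_cases h : ∃ s, s < τ ∧ σ.pick q = some s
  · rw [if_pos h]
    have hq : q ∉ pending σ Rhat R τ := fun hq => hq.2 h
    obtain ⟨s', hs', hqs'⟩ := h
    simp only [hq, false_and, or_false, hqs', Option.some.injEq]
    constructor
    · rintro rfl; exact ⟨hs', rfl⟩
    · exact And.right
  · rw [if_neg h]
    have h' : ¬ (s < τ ∧ σ.pick q = some s) := fun h' => h ⟨s, h'⟩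
    by_cases hq : q ∈ pending σ Rhat R τ
    · simp [hq, h']
    · simp [hq, h']

theorem splice_pick_of_lt (hX : IsGeodesic X) {q : Request X} {s : ℝ} (hs : s < τ) :
    (splice o Rhat R σ τ).pick q = some s ↔ σ.pick q = some s := by
  rw [splice_pick_iff]
  obtain ⟨c, hc, -⟩ := fastestTour_spec hX (σ.pos τ) τ o (pending_finite σ Rhat R τ)
  constructor
  · rintro (h | ⟨h1, rfl⟩)
    · exact h.2
    · exact absurd hs (not_lt.2 (hc.start_le_pick q h1))
  · exact fun h => Or.inl ⟨hs, h⟩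

theorem agreeUpTo_splice (hX : IsGeodesic X) (ht : t < τ) :
    AgreeUpTo t (splice o Rhat R σ τ) σ :=
  ⟨fun _ _ hs => splice_pos (hs.trans ht.le), fun _ _ hs => splice_pick_of_lt hX (hs.trans_lt ht)⟩

theorem splice_pos_of_ge (hX : IsGeodesic X) (ht : τ ≤ t) : (splice o Rhat R σ τ).pos t =
    (fastestTour (σ.pos τ) τ o (pending σ Rhat R τ)).1 t := by
  obtain ⟨c, hc, -⟩ := fastestTour_spec hX (σ.pos τ) τ o (pending_finite σ Rhat R τ)
  rcases ht.eq_or_lt with rfl | ht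
  · rw [splice_pos le_rfl, hc.start]
  · exact if_neg (not_le.2 ht)

/-- Since the server is free at `τ`, every earlier ride is over and cannot collide with the new
tour. -/
theorem splice_feasible (hX : IsGeodesic X) (hσ : σ.Feasible o V)
    (hV : ∀ q ∈ V, q ∈ R ∨ q ∈ Rhat) (hτ : 0 ≤ τ) (hb : ¬ σ.Busy τ) :
    (splice o Rhat R σ τ).Feasible o {q | q ∈ R ∨ q ∈ Rhat} := by
  obtain ⟨c, hc, -⟩ := fastestTour_spec hX (σ.pos τ) τ o (pending_finite σ Rhat R τ)
  have hlen : ∀ q s, s < τ → σ.pick q = some s → s + q.len ≤ τ :=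
    fun q s hs hq => le_of_not_busy hb hq hs
  refine ⟨?_, ?_, ?_, ?_, ?_, ?_, ?_⟩
  · rw [splice_pos hτ, hσ.start]
  · intro s t hs hst
    rcases le_total t τ with h1 | h1
    · rw [splice_pos h1, splice_pos (hst.trans h1)]
      exact hσ.speed s t hs hst
    · rcases le_total s τ with h2 | h2
      · rw [splice_pos h2, splice_pos_of_ge hX h1]
        have e1 := hσ.speed s τ hs h2
        have e2 := hc.speed τ t le_rfl h1
        rw [hc.start] at e2
        linarith [dist_triangle (σ.pos s) (σ.pos τ)
          ((fastestTour (σ.pos τ) τ o (pending σ Rhat R τ)).1 t)]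
      · rw [splice_pos_of_ge hX h1, splice_pos_of_ge hX h2]
        exact hc.speed s t h2 hst
  · intro q s hq
    rcases splice_pick_iff.1 hq with ⟨-, h⟩ | ⟨h, -⟩
    · exact hV q (hσ.mem q s h)
    · exact h.1.symm.imp And.left id
  · intro q s hq
    rcases splice_pick_iff.1 hq with ⟨-, h⟩ | ⟨h, rfl⟩
    · exact hσ.release_le q s h
    · exact hc.release_le q h
  · intro q s hq
    rcases splice_pick_iff.1 hq with ⟨h1, h⟩ | ⟨h, rfl⟩
    · rw [splice_pos h1.le]; exact hσ.pick_up q s h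
    · rw [splice_pos_of_ge hX (hc.start_le_pick q h)]; exact hc.pick_up q h
  · intro q s hq
    rcases splice_pick_iff.1 hq with ⟨h1, h⟩ | ⟨h, rfl⟩
    · rw [splice_pos (hlen q s h1 h)]; exact hσ.deliver q s h
    · rw [splice_pos_of_ge hX (by linarith [hc.start_le_pick q h, q.len_nonneg])]
      exact hc.deliver q h
  · intro q s q' s' hq hq' hne
    rcases splice_pick_iff.1 hq with ⟨h1, h⟩ | ⟨h, rfl⟩ <;>
      rcases splice_pick_iff.1 hq' with ⟨h1', h'⟩ | ⟨h', rfl⟩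
    · exact hσ.capacity q s q' s' h h' hne
    · exact Or.inl ((hlen q s h1 h).trans (hc.start_le_pick q' h'))
    · exact Or.inr ((hlen q' s' h1' h').trans (hc.start_le_pick q h))
    · exact hc.capacity q h q' h' hne

theorem pending_splice (hX : IsGeodesic X) :
    pending (splice o Rhat R σ τ) Rhat R τ = pending σ Rhat R τ :=
  pending_congr (fun _ _ hs => splice_pick_of_lt hX hs) fun _ _ _ => Iff.rfl

theorem splice_follows (hX : IsGeodesic X) (o : X) (Rhat R : Finset (Request X))
    (σ : Schedule X) (τ : ℝ) :
    ∃ c p k, IsTour ((splice o Rhat R σ τ).pos τ) τ o (pending (splice o Rhat R σ τ) Rhat R τ)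
        c p k ∧
      IsLeast (tourTimes ((splice o Rhat R σ τ).pos τ) τ o
        (pending (splice o Rhat R σ τ) Rhat R τ)) c ∧
      (∀ t, τ ≤ t → (splice o Rhat R σ τ).pos t = p t) ∧
      ∀ q s, τ ≤ s → ((splice o Rhat R σ τ).pick q = some s ↔
        q ∈ pending (splice o Rhat R σ τ) Rhat R τ ∧ k q = s) := by
  obtain ⟨c, hc, hc'⟩ := fastestTour_spec hX (σ.pos τ) τ o (pending_finite σ Rhat R τ)
  rw [splice_pos le_rfl, pending_splice hX]
  refine ⟨c, _, _, hc, hc', fun t ht => splice_pos_of_ge hX ht, fun q s hs => ?_⟩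
  rw [splice_pick_iff]
  constructor
  · rintro (h | h)
    · exact absurd h.1 (not_lt.2 hs)
    · exact h
  · exact Or.inr

/-- The first time from `r` on at which the server is not on a ride. -/
noncomputable def firstFree (σ : Schedule X) (r : ℝ) : ℝ :=
  Classical.epsilon fun τ => r ≤ τ ∧ ¬ σ.Busy τ ∧ ∀ t, r ≤ t → t < τ → σ.Busy t

theorem firstFree_spec (hσ : σ.Feasible o {q | q ∈ R ∨ q ∈ Rhat}) (r : ℝ) :
    r ≤ firstFree σ r ∧ ¬ σ.Busy (firstFree σ r) ∧ ∀ t, r ≤ t → t < firstFree σ r → σ.Busy t :=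
  Classical.epsilon_spec (hσ.exists_first_free
    (((R.finite_toSet).union Rhat.finite_toSet).subset fun _ hq => hq) r)

/-! ### The first two phases -/

variable {a a' : Schedule X} {T t₁ : ℝ}

/-- At time `t₁` the server has to leave for the origin in order to be there at time `T`. -/
def IsTurn (o : X) (T : ℝ) (a : Schedule X) (t₁ : ℝ) : Prop :=
  0 ≤ t₁ ∧ t₁ + dist (a.pos t₁) o = T ∧ ∀ t, 0 ≤ t → (t + dist (a.pos t) o ≤ T ↔ t ≤ t₁)

/-- By unit speed `t + dist (a.pos t) o` is nondecreasing and grows at rate at most 2, so it stays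
at most `T` exactly on an interval `[0, t₁]`, with equality at `t₁`. -/
theorem exists_isTurn (ha : a.Feasible o V) (hT : 0 ≤ T) : ∃ t₁, IsTurn o T a t₁ := by
  have hmono : ∀ s t, 0 ≤ s → s ≤ t → s + dist (a.pos s) o ≤ t + dist (a.pos t) o := by
    intro s t hs hst
    linarith [ha.speed s t hs hst, dist_triangle (a.pos s) (a.pos t) o]
  have hgrow : ∀ s t, 0 ≤ s → s ≤ t → t + dist (a.pos t) o ≤ s + dist (a.pos s) o + 2 * (t - s) := by
    intro s t hs hst
    have := ha.speed s t hs hst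
    rw [dist_comm] at this
    linarith [dist_triangle (a.pos t) (a.pos s) o]
  set E : Set ℝ := {t | 0 ≤ t ∧ t + dist (a.pos t) o ≤ T} with hE
  have mE : ∀ t, t ∈ E ↔ 0 ≤ t ∧ t + dist (a.pos t) o ≤ T := fun t => Iff.rfl
  have hE0 : (0 : ℝ) ∈ E := ⟨le_rfl, by rw [ha.start, dist_self]; linarith⟩
  have hEb : BddAbove E := ⟨T, fun t ht => by
    linarith [((mE t).1 ht).2, dist_nonneg (x := a.pos t) (y := o)]⟩
  have h0 : 0 ≤ sSup E := le_csSup hEb hE0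
  have hle : sSup E + dist (a.pos (sSup E)) o ≤ T := by
    refine le_of_forall_pos_le_add fun ε hε => ?_
    obtain ⟨t, ht, hlt⟩ := exists_lt_of_lt_csSup ⟨0, hE0⟩ (show sSup E - ε / 2 < sSup E by linarith)
    linarith [hgrow t (sSup E) ht.1 (le_csSup hEb ht), ((mE t).1 ht).2]
  refine ⟨sSup E, h0, le_antisymm hle ?_, fun t ht => ⟨fun h => le_csSup hEb ⟨ht, h⟩,
    fun h => (hmono t _ ht h).trans hle⟩⟩
  by_contra! hlt
  set ε := (T - (sSup E + dist (a.pos (sSup E)) o)) / 2 with hε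
  have hε0 : 0 < ε := by linarith
  have := le_csSup hEb (show sSup E + ε ∈ E from
    ⟨by linarith, by linarith [hgrow (sSup E) (sSup E + ε) h0 (by linarith)]⟩)
  linarith

/-- Once the turning time has passed, it is determined by the motion so far: turning is an online
decision. -/
theorem IsTurn.congr (h : IsTurn o T a t₁) (hlt : t₁ < t) {t₁' : ℝ} (h' : IsTurn o T a' t₁')
    (hag : ∀ s, 0 ≤ s → s ≤ t → a.pos s = a'.pos s) : t₁' = t₁ := by
  have ht0 : 0 ≤ t := h.1.trans hlt.le
  have h2 : ¬ t ≤ t₁' := by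
    rw [← h'.2.2 t ht0, ← hag t ht0 le_rfl, h.2.2 t ht0]
    exact not_le.2 hlt
  push Not at h2
  refine le_antisymm ?_ ?_
  · rw [← h.2.2 _ h'.1, hag _ h'.1 h2.le]
    exact h'.2.1.le
  · rw [← h'.2.2 _ h.1, ← hag _ h.1 hlt.le]
    exact h.2.1.le

noncomputable def turn (o : X) (T : ℝ) (a : Schedule X) : ℝ := Classical.epsilon (IsTurn o T a)

theorem turn_spec (ha : a.Feasible o V) (hT : 0 ≤ T) : IsTurn o T a (turn o T a) :=
  Classical.epsilon_spec (exists_isTurn ha hT)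

/-- A path that leaves `x` at time `t₁` and is in `o` from time `T` on. -/
noncomputable def homePath (o : X) (T : ℝ) (x : X) (t₁ : ℝ) : ℝ → X :=
  @Classical.epsilon _ ⟨fun _ => o⟩ fun p : ℝ → X =>
    (∀ s t, s ≤ t → dist (p s) (p t) ≤ t - s) ∧ (∀ t, t ≤ t₁ → p t = x) ∧ ∀ t, T ≤ t → p t = o

theorem homePath_spec (hX : IsGeodesic X) {x : X} (h : t₁ + dist x o = T) :
    (∀ s t, s ≤ t → dist (homePath o T x t₁ s) (homePath o T x t₁ t) ≤ t - s) ∧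
      (∀ t, t ≤ t₁ → homePath o T x t₁ t = x) ∧ ∀ t, T ≤ t → homePath o T x t₁ t = o := by
  obtain ⟨p, h1, h2, h3⟩ := exists_path_extend hX (fun _ => x) t₁
    (fun s t hst => by rw [dist_self]; linarith) T o (by linarith [dist_nonneg (x := x) (y := o)])
    (by linarith)
  exact Classical.epsilon_spec (p := fun p : ℝ → X => (∀ s t, s ≤ t → dist (p s) (p t) ≤ t - s) ∧
    (∀ t, t ≤ t₁ → p t = x) ∧ ∀ t, T ≤ t → p t = o) ⟨p, h1, h2, h3⟩

open scoped Classical in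
/-- Follow `a` as long as it is possible to be back in the origin at time `T`. -/
noncomputable def followThenHome (o : X) (T : ℝ) (a : Schedule X) : Schedule X where
  pos t := if t ≤ turn o T a then a.pos t else homePath o T (a.pos (turn o T a)) (turn o T a) t
  pick q := if ∃ s, a.pick q = some s ∧ s + q.len + dist q.dst o ≤ T then a.pick q else none

theorem followThenHome_pos (ht : t ≤ turn o T a) : (followThenHome o T a).pos t = a.pos t :=
  if_pos ht

theorem followThenHome_pick_iff {q : Request X} {s : ℝ} :
    (followThenHome o T a).pick q = some s ↔
      a.pick q = some s ∧ s + q.len + dist q.dst o ≤ T := by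
  classical
  unfold followThenHome
  dsimp only
  split_ifs with h
  · obtain ⟨s', h1, h2⟩ := h
    rw [h1, Option.some.injEq]
    constructor
    · rintro rfl; exact ⟨rfl, h2⟩
    · exact And.left
  · simp only [false_iff]
    exact fun h' => h ⟨s, h'⟩

theorem followThenHome_pos_of_ge (hX : IsGeodesic X) (ha : a.Feasible o V) (hT : 0 ≤ T)
    (ht : turn o T a ≤ t) : (followThenHome o T a).pos t =
      homePath o T (a.pos (turn o T a)) (turn o T a) t := by
  rcases ht.eq_or_lt with rfl | ht
  · rw [followThenHome_pos le_rfl, (homePath_spec hX (turn_spec ha hT).2.1).2.1 _ le_rfl]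
  · exact if_neg (not_le.2 ht)

theorem followThenHome_feasible (hX : IsGeodesic X) (ha : a.Feasible o V) (hT : 0 ≤ T) :
    (followThenHome o T a).Feasible o V := by
  have hturn := turn_spec ha hT
  obtain ⟨h1, h2, h3⟩ := homePath_spec hX hturn.2.1
  have hride : ∀ q s, a.pick q = some s → s + q.len + dist q.dst o ≤ T →
      s + q.len ≤ turn o T a := by
    intro q s hq hs
    rw [← hturn.2.2 _ (by linarith [ha.nonneg hq, q.len_nonneg]), ha.deliver q s hq]
    exact hs
  refine ⟨?_, ?_, ?_, ?_, ?_, ?_, ?_⟩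
  · rw [followThenHome_pos hturn.1, ha.start]
  · intro s t hs hst
    rcases le_total t (turn o T a) with e | e
    · rw [followThenHome_pos e, followThenHome_pos (hst.trans e)]
      exact ha.speed s t hs hst
    · rw [followThenHome_pos_of_ge hX ha hT e]
      rcases le_total s (turn o T a) with e' | e'
      · rw [followThenHome_pos e']
        have g1 := ha.speed s _ hs e'
        have g2 := h1 _ t e
        rw [h2 _ le_rfl] at g2
        linarith [dist_triangle (a.pos s) (a.pos (turn o T a))
          (homePath o T (a.pos (turn o T a)) (turn o T a) t)]
      · rw [followThenHome_pos_of_ge hX ha hT e']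
        exact h1 s t hst
  · exact fun q s hq => ha.mem q s (followThenHome_pick_iff.1 hq).1
  · exact fun q s hq => ha.release_le q s (followThenHome_pick_iff.1 hq).1
  · intro q s hq
    obtain ⟨g1, g2⟩ := followThenHome_pick_iff.1 hq
    rw [followThenHome_pos (by linarith [hride q s g1 g2, q.len_nonneg])]
    exact ha.pick_up q s g1
  · intro q s hq
    obtain ⟨g1, g2⟩ := followThenHome_pick_iff.1 hq
    rw [followThenHome_pos (hride q s g1 g2)]
    exact ha.deliver q s g1
  · exact fun q s q' s' hq hq' => ha.capacity q s q' s' (followThenHome_pick_iff.1 hq).1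
      (followThenHome_pick_iff.1 hq').1

theorem followThenHome_not_busy : ¬ (followThenHome o T a).Busy T := by
  rintro ⟨q, s, hq, -, h2⟩
  have := (followThenHome_pick_iff.1 hq).2
  linarith [dist_nonneg (x := q.dst) (y := o)]

/-- The way home is exactly as long as the time left, so none of it can be lost. -/
theorem followThenHome_go_home (hX : IsGeodesic X) (ha : a.Feasible o V) (hT : 0 ≤ T)
    (ht₀ : 0 ≤ t) (htT : t ≤ T) (h : T < t + dist (a.pos t) o) :
    t + dist ((followThenHome o T a).pos t) o = T := by
  have hturn := turn_spec ha hT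
  have hlt : turn o T a < t := by
    by_contra! hle
    exact absurd ((hturn.2.2 t ht₀).2 hle) (not_le.2 h)
  obtain ⟨h1, h2, h3⟩ := homePath_spec hX hturn.2.1
  rw [followThenHome_pos_of_ge hX ha hT hlt.le]
  have g1 := h1 t T htT
  rw [h3 T le_rfl] at g1
  have g2 := h1 _ t hlt.le
  rw [h2 _ le_rfl] at g2
  have := hturn.2.1
  linarith [dist_triangle (a.pos (turn o T a)) (homePath o T (a.pos (turn o T a)) (turn o T a) t) o]

theorem agreeUpTo_followThenHome {V' : Set (Request X)}
    (ha : a.Feasible o V) (ha' : a'.Feasible o V') (hT : 0 ≤ T) (h : AgreeUpTo t a a') :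
    AgreeUpTo t (followThenHome o T a) (followThenHome o T a') := by
  have hturn := turn_spec ha hT
  have hturn' := turn_spec ha' hT
  refine ⟨fun s hs0 hst => ?_, fun q s hs => ?_⟩
  · by_cases hs : s ≤ turn o T a
    · have hs' : s ≤ turn o T a' := by
        rwa [← hturn'.2.2 s hs0, ← h.1 s hs0 hst, hturn.2.2 s hs0]
      rw [followThenHome_pos hs, followThenHome_pos hs', h.1 s hs0 hst]
    · push Not at hs
      have he : turn o T a' = turn o T a :=
        hturn.congr hs hturn' fun r h0 hr => h.1 r h0 (hr.trans hst)
      have e1 : (followThenHome o T a).pos s =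
          homePath o T (a.pos (turn o T a)) (turn o T a) s := if_neg (not_le.2 hs)
      have e2 : (followThenHome o T a').pos s =
          homePath o T (a'.pos (turn o T a')) (turn o T a') s := if_neg (not_le.2 (he ▸ hs))
      rw [e1, e2, he, h.1 _ hturn.1 (hs.le.trans hst)]
  · rw [followThenHome_pick_iff, followThenHome_pick_iff, h.2 q s hs]

end Construction

/-! ### Removing the latest unexpected requests -/

section LateRequests

variable {X : Type u} {T : ℝ} {Rhat R : Finset (Request X)}

theorem AgreeUpTo.refl (t : ℝ) (σ : Schedule X) : AgreeUpTo t σ σ :=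
  ⟨fun _ _ _ => rfl, fun _ _ _ => Iff.rfl⟩

open scoped Classical in
/-- The unexpected requests released after time `T`. -/
noncomputable def lateRequests (Rhat : Finset (Request X)) (T : ℝ) (R : Finset (Request X)) :
    Finset (Request X) := R.filter fun q => q ∉ Rhat ∧ T < q.release

theorem mem_lateRequests {q : Request X} :
    q ∈ lateRequests Rhat T R ↔ q ∈ R ∧ q ∉ Rhat ∧ T < q.release := by
  classical
  simp [lateRequests]

/-- The requests released before time `l`. -/
noncomputable def releasedBefore (R : Finset (Request X)) (l : ℝ) : Finset (Request X) :=
  R.filter fun q => q.release < l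

theorem mem_releasedBefore {q : Request X} {l : ℝ} :
    q ∈ releasedBefore R l ↔ q ∈ R ∧ q.release < l := by
  simp [releasedBefore]

theorem exists_release_eq_sup' (h : (lateRequests Rhat T R).Nonempty) :
    ∃ q ∈ lateRequests Rhat T R, (lateRequests Rhat T R).sup' h Request.release = q.release :=
  Finset.exists_mem_eq_sup' h _

theorem card_releasedBefore_lt (h : (lateRequests Rhat T R).Nonempty) :
    (releasedBefore R ((lateRequests Rhat T R).sup' h Request.release)).card < R.card := by
  obtain ⟨q, hq, he⟩ := exists_release_eq_sup' h
  refine Finset.card_lt_card (Finset.filter_ssubset.2 ⟨q, (mem_lateRequests.1 hq).1, ?_⟩)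
  rw [he]
  exact lt_irrefl _

end LateRequests

/-! ### The framework as an online algorithm -/

section Framework

variable {X : Type u} [MetricSpace X] {o : X} {α T t : ℝ} {Rhat R R' : Finset (Request X)}

open scoped Classical in
/-- A run of the framework; the schedule is spliced at the time when a tour is recomputed for the
unexpected requests that are released last. -/
noncomputable def frameworkRun (A : OnlineAlgorithm o ∅) (Rhat : Finset (Request X)) (T : ℝ)
    (R : Finset (Request X)) : Schedule X :=
  if h : (lateRequests Rhat T R).Nonempty then
    let l := (lateRequests Rhat T R).sup' h Request.release
    let σ := frameworkRun A Rhat T (releasedBefore R l)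
    splice o Rhat R σ (firstFree σ l)
  else splice o Rhat R (followThenHome o T (A.run R)) T
termination_by R.card
decreasing_by exact card_releasedBefore_lt h

variable {A : OnlineAlgorithm o ∅}

theorem frameworkRun_of_not_nonempty (h : ¬ (lateRequests Rhat T R).Nonempty) :
    frameworkRun A Rhat T R = splice o Rhat R (followThenHome o T (A.run R)) T := by
  rw [frameworkRun, dif_neg h]

theorem frameworkRun_of_nonempty (h : (lateRequests Rhat T R).Nonempty) :
    frameworkRun A Rhat T R =
      splice o Rhat R (frameworkRun A Rhat T
        (releasedBefore R ((lateRequests Rhat T R).sup' h Request.release)))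
        (firstFree (frameworkRun A Rhat T
          (releasedBefore R ((lateRequests Rhat T R).sup' h Request.release)))
          ((lateRequests Rhat T R).sup' h Request.release)) := by
  rw [frameworkRun, dif_pos h]

theorem isAlgoGenRun_splice_base (hX : IsGeodesic X) (hα : 0 ≤ α * opt o Rhat)
    (h : ¬ (lateRequests Rhat (α * opt o Rhat) R).Nonempty) :
    IsAlgoGenRun o α (A.run R)
      (splice o Rhat R (followThenHome o (α * opt o Rhat) (A.run R)) (α * opt o Rhat)) Rhat R := by
  set T := α * opt o Rhat with hT
  set a := A.run R with ha'
  have ha := A.feasible R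
  have hturn := turn_spec ha hα
  refine ⟨fun t ht0 ht => ?_, fun q s hs => ?_, fun t ht0 htT ht => ?_, ?_⟩
  · rw [splice_pos (by linarith [dist_nonneg (x := a.pos t) (y := o)]),
      followThenHome_pos ((hturn.2.2 t ht0).1 ht)]
  · rw [splice_pick_of_lt hX hs, followThenHome_pick_iff]
  · rw [splice_pos htT]
    exact followThenHome_go_home hX ha hα ht0 htT ht
  · intro τ hτ
    obtain rfl : τ = T := by
      rcases hτ with hτ | ⟨q, h1, h2, h3, -⟩
      · exact hτ
      · exact absurd ⟨q, mem_lateRequests.2 ⟨h1, h2, h3⟩⟩ h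
    obtain ⟨c, p, k, h1, h2, h3, h4⟩ := splice_follows hX o Rhat R (followThenHome o T a) T
    exact ⟨c, p, k, h1, h2, fun t ht _ => h3 t ht, fun q s hs _ => h4 q s hs⟩

/-- Replanning for the unexpected requests that are released last. -/
theorem isAlgoGenRun_splice_step (hX : IsGeodesic X) {l : ℝ} {σ : Schedule X}
    (hl : α * opt o Rhat < l) (hlq : ∃ q ∈ R, q ∉ Rhat ∧ q.release = l)
    (hmax : ∀ q ∈ R, q ∉ Rhat → α * opt o Rhat < q.release → q.release ≤ l)
    (hσ : σ.Feasible o {q | q ∈ releasedBefore R l ∨ q ∈ Rhat})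
    (h : IsAlgoGenRun o α (A.run (releasedBefore R l)) σ Rhat (releasedBefore R l)) :
    IsAlgoGenRun o α (A.run R) (splice o Rhat R σ (firstFree σ l)) Rhat R := by
  set T := α * opt o Rhat with hT
  set τ := firstFree σ l with hτdef
  obtain ⟨hlτ, hτfree, hτbusy⟩ := firstFree_spec hσ l
  rw [← hτdef] at hlτ hτfree hτbusy
  have hTτ : T < τ := hl.trans_le hlτ
  have hpick : ∀ q s, s < τ → ((splice o Rhat R σ τ).pick q = some s ↔ σ.pick q = some s) :=
    fun q s hs => splice_pick_of_lt hX hs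
  have hbusy : ∀ t, t ≤ τ → ((splice o Rhat R σ τ).Busy t ↔ σ.Busy t) :=
    fun t ht => busy_congr ht hpick
  obtain ⟨hag₁, hag₂⟩ := A.causal R (releasedBefore R l) T fun q hq => by
    rw [mem_releasedBefore]
    exact ⟨fun h => ⟨h, hq.trans_lt hl⟩, And.left⟩
  -- Nothing changes before `τ`, so earlier replanning times are kept. Requests released during the
  -- ride that ends at `τ` lead to `τ` as well.
  have hreplan : ∀ τ', IsReplanTime (splice o Rhat R σ τ) Rhat R T τ' →
      τ' = τ ∨ (IsReplanTime σ Rhat (releasedBefore R l) T τ' ∧ τ' < τ) := by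
    rintro τ' (rfl | ⟨q, h1, h2, h3, h4, h5, h6⟩)
    · exact Or.inr ⟨Or.inl rfl, hTτ⟩
    · have hql := hmax q h1 h2 h3
      have hle : τ' ≤ τ := by
        by_contra! hlt
        exact hτfree ((hbusy τ le_rfl).1 (h6 τ (hql.trans hlτ) hlt))
      rcases hle.eq_or_lt with he | hlt
      · exact Or.inl he
      · rw [hbusy _ hle] at h5
        have hτ'l : τ' < l := by
          by_contra! hle'
          exact h5 (hτbusy τ' hle' hlt)
        refine Or.inr ⟨Or.inr ⟨q, mem_releasedBefore.2 ⟨h1, h4.trans_lt hτ'l⟩, h2, h3, h4, h5,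
          fun t ht ht' => ?_⟩, hlt⟩
        exact (hbusy t (ht'.le.trans hle)).1 (h6 t ht ht')
  have hreplan₁ : IsReplanTime (splice o Rhat R σ τ) Rhat R T τ := by
    obtain ⟨q, h1, h2, h3⟩ := hlq
    refine Or.inr ⟨q, h1, h2, h3 ▸ hl, h3 ▸ hlτ, fun h => hτfree ((hbusy τ le_rfl).1 h),
      fun t ht ht' => (hbusy t ht'.le).2 (hτbusy t (h3 ▸ ht) ht')⟩
  have hreplan₂ : ∀ τ', IsReplanTime σ Rhat (releasedBefore R l) T τ' →
      IsReplanTime (splice o Rhat R σ τ) Rhat R T τ' := by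
    rintro τ' (rfl | ⟨q, h1, h2, h3, h4, h5, h6⟩)
    · exact Or.inl rfl
    · obtain ⟨h1, h1'⟩ := mem_releasedBefore.1 h1
      have hle : τ' ≤ τ := by
        by_contra! hlt
        exact hτfree (h6 τ (h1'.le.trans hlτ) hlt)
      exact Or.inr ⟨q, h1, h2, h3, h4, fun h => h5 ((hbusy _ hle).1 h),
        fun t ht ht' => (hbusy t (ht'.le.trans hle)).2 (h6 t ht ht')⟩
  refine ⟨fun t ht0 ht => ?_, fun q s hs => ?_, fun t ht0 htT ht => ?_, ?_⟩
  · have htT : t ≤ T := by linarith [dist_nonneg (x := (A.run R).pos t) (y := o)]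
    rw [hag₁ t ht0 htT] at ht ⊢
    rw [splice_pos (htT.trans hTτ.le)]
    exact h.follow t ht0 ht
  · rw [hpick q s (hs.trans hTτ), hag₂ q s hs.le]
    exact h.follow_pick q s hs
  · rw [hag₁ t ht0 htT] at ht
    rw [splice_pos (htT.trans hTτ.le)]
    exact h.go_home t ht0 htT ht
  · intro τ' hτ'
    rcases hreplan τ' hτ' with rfl | ⟨hr, hlt⟩
    · obtain ⟨c, p, k, h1, h2, h3, h4⟩ := splice_follows hX o Rhat R σ τ
      exact ⟨c, p, k, h1, h2, fun t ht _ => h3 t ht, fun q s hs _ => h4 q s hs⟩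
    · obtain ⟨c, p, k, h1, h2, h3, h4⟩ := h.replan τ' hr
      -- The server is busy from `l` until `τ`; hence earlier replannings take place before `l`,
      -- when the dropped requests are unknown.
      have hτ'l : τ' < l := by
        by_contra! hle
        exact hr.not_busy h.not_busy (hτbusy τ' hle hlt)
      have hpend : pending (splice o Rhat R σ τ) Rhat R τ' =
          pending σ Rhat (releasedBefore R l) τ' :=
        pending_congr (fun q s hs => hpick q s (hs.trans hlt)) fun q _ hq => by
          rw [mem_releasedBefore]
          exact ⟨fun h => ⟨h, hq.trans_lt hτ'l⟩, And.left⟩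
      rw [hpend, splice_pos hlt.le]
      refine ⟨c, p, k, h1, h2, fun t ht hnext => ?_, fun q s hs hnext => ?_⟩
      · rw [splice_pos (hnext τ hreplan₁ hlt)]
        exact h3 t ht fun τ'' h5 h6 => hnext τ'' (hreplan₂ τ'' h5) h6
      · rw [hpick q s (hnext τ hreplan₁ hlt)]
        exact h4 q s hs fun τ'' h5 h6 => hnext τ'' (hreplan₂ τ'' h5) h6

theorem frameworkRun_spec (hX : IsGeodesic X) (hα : 0 ≤ α * opt o Rhat)
    (A : OnlineAlgorithm o ∅) (R : Finset (Request X)) :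
    (frameworkRun A Rhat (α * opt o Rhat) R).Feasible o {q | q ∈ R ∨ q ∈ Rhat} ∧
      IsAlgoGenRun o α (A.run R) (frameworkRun A Rhat (α * opt o Rhat) R) Rhat R := by
  induction hn : R.card using Nat.strong_induction_on generalizing R with
  | _ n ih =>
    by_cases h : (lateRequests Rhat (α * opt o Rhat) R).Nonempty
    · rw [frameworkRun_of_nonempty h]
      obtain ⟨hσ, hr⟩ := ih _ (hn ▸ card_releasedBefore_lt h) _ rfl
      obtain ⟨q, hq, hql⟩ := exists_release_eq_sup' h
      obtain ⟨h1, h2, h3⟩ := mem_lateRequests.1 hq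
      set l := (lateRequests Rhat (α * opt o Rhat) R).sup' h Request.release with hl
      have hTl : α * opt o Rhat < l := hql ▸ h3
      obtain ⟨g1, g2, -⟩ := firstFree_spec hσ l
      refine ⟨splice_feasible hX hσ (fun q hq => hq.imp (fun h => (mem_releasedBefore.1 h).1) id)
        (hα.trans (hTl.le.trans g1)) g2, isAlgoGenRun_splice_step hX hTl ⟨q, h1, h2, hql.symm⟩
        (fun q' h1' h2' h3' => ?_) hσ hr⟩
      exact Finset.le_sup' Request.release (mem_lateRequests.2 ⟨h1', h2', h3'⟩)
    · rw [frameworkRun_of_not_nonempty h]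
      refine ⟨splice_feasible hX (followThenHome_feasible hX (A.feasible R) hα) ?_ hα
        followThenHome_not_busy, isAlgoGenRun_splice_base hX hα h⟩
      rintro q (hq | hq)
      · exact Or.inl hq
      · exact absurd hq (Finset.notMem_empty q)

/-- Late requests with the latest date after `t` can be peeled off either instance, as they only act
through a splice after `t`. When no more can be peeled, both instances have the same late requests,
and the recursion takes the same steps on both. -/
theorem agreeUpTo_frameworkRun (hX : IsGeodesic X) (hα : 0 ≤ α * opt o Rhat)
    (A : OnlineAlgorithm o ∅) (R R' : Finset (Request X)) (t : ℝ)
    (hR : ∀ q : Request X, q.release ≤ t → (q ∈ R ↔ q ∈ R')) :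
    AgreeUpTo t (frameworkRun A Rhat (α * opt o Rhat) R)
      (frameworkRun A Rhat (α * opt o Rhat) R') := by
  induction hn : R.card + R'.card using Nat.strong_induction_on generalizing R R' with
  | _ n ih =>
    set T := α * opt o Rhat with hT
    have peel : ∀ R₁ : Finset (Request X), ∀ h : (lateRequests Rhat T R₁).Nonempty,
        t < (lateRequests Rhat T R₁).sup' h Request.release →
        AgreeUpTo t (frameworkRun A Rhat T R₁) (frameworkRun A Rhat T
          (releasedBefore R₁ ((lateRequests Rhat T R₁).sup' h Request.release))) := by
      intro R₁ h hlt
      rw [frameworkRun_of_nonempty h]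
      exact agreeUpTo_splice hX
        (hlt.trans_le (firstFree_spec (frameworkRun_spec hX hα A _).1 _).1)
    by_cases h : ∃ h : (lateRequests Rhat T R).Nonempty,
        t < (lateRequests Rhat T R).sup' h Request.release
    · obtain ⟨h, hlt⟩ := h
      refine (peel R h hlt).trans (ih _ ?_ _ R' (fun q hq => ?_) rfl)
      · have := card_releasedBefore_lt h
        omega
      · rw [mem_releasedBefore, ← hR q hq]
        exact ⟨And.left, fun h' => ⟨h', hq.trans_lt hlt⟩⟩
    by_cases h' : ∃ h : (lateRequests Rhat T R').Nonempty,
        t < (lateRequests Rhat T R').sup' h Request.release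
    · obtain ⟨h', hlt⟩ := h'
      refine AgreeUpTo.trans (ih _ ?_ R _ (fun q hq => ?_) rfl) (peel R' h' hlt).symm
      · have := card_releasedBefore_lt h'
        omega
      · rw [mem_releasedBefore, hR q hq]
        exact ⟨fun h' => ⟨h', hq.trans_lt hlt⟩, And.left⟩
    have hle : ∀ R₁ : Finset (Request X), (¬ ∃ h : (lateRequests Rhat T R₁).Nonempty,
        t < (lateRequests Rhat T R₁).sup' h Request.release) →
        ∀ q ∈ lateRequests Rhat T R₁, q.release ≤ t := by
      intro R₁ h₁ q hq
      by_contra! hlt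
      exact h₁ ⟨⟨q, hq⟩, hlt.trans_le (Finset.le_sup' Request.release hq)⟩
    have hL : lateRequests Rhat T R = lateRequests Rhat T R' := by
      ext q
      constructor <;> intro hq
      · have hqt := hle R h q hq
        rw [mem_lateRequests] at hq ⊢
        exact ⟨(hR q hqt).1 hq.1, hq.2⟩
      · have hqt := hle R' h' q hq
        rw [mem_lateRequests] at hq ⊢
        exact ⟨(hR q hqt).2 hq.1, hq.2⟩
    -- The instances may still differ in predicted requests, but these are pending whether or not
    -- they appear.
    have hmem : T ≤ t → ∀ q, q ∉ Rhat → (q ∈ R ↔ q ∈ R') := by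
      intro hTt q hq
      by_cases hqT : q.release ≤ T
      · exact hR q (hqT.trans hTt)
      · push Not at hqT
        have := Finset.ext_iff.1 hL q
        simpa [mem_lateRequests, hq, hqT] using this
    by_cases hne : (lateRequests Rhat T R).Nonempty
    · have hne' : (lateRequests Rhat T R').Nonempty := hL ▸ hne
      have hsup : (lateRequests Rhat T R').sup' hne' Request.release =
          (lateRequests Rhat T R).sup' hne Request.release := by
        congr 1
        exact hL.symm
      rw [frameworkRun_of_nonempty hne, frameworkRun_of_nonempty hne', hsup]
      set l := (lateRequests Rhat T R).sup' hne Request.release with hl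
      obtain ⟨q, hq, hql⟩ := exists_release_eq_sup' hne
      have hlt : l ≤ t := hl ▸ hql ▸ hle R h q hq
      have hTl : T < l := hl ▸ hql ▸ (mem_lateRequests.1 hq).2.2
      have hbefore : releasedBefore R l = releasedBefore R' l := by
        ext q
        rw [mem_releasedBefore, mem_releasedBefore]
        exact and_congr_left fun h => hR q (h.le.trans hlt)
      rw [hbefore]
      unfold splice
      rw [pending_congr (R := R) (R' := R') (fun _ _ _ => Iff.rfl)
        fun q hq _ => hmem (hTl.le.trans hlt) q hq]
      exact AgreeUpTo.refl _ _
    · have hne' : ¬ (lateRequests Rhat T R').Nonempty := hL ▸ hne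
      rw [frameworkRun_of_not_nonempty hne, frameworkRun_of_not_nonempty hne']
      have ha := A.feasible R
      have ha' := A.feasible R'
      rcases lt_or_ge t T with htT | hTt
      · exact ((agreeUpTo_splice hX htT).trans (agreeUpTo_followThenHome ha ha' hα
          (A.causal R R' t hR))).trans (agreeUpTo_splice hX htT).symm
      · have hag := agreeUpTo_followThenHome (T := T) ha ha' hα
          (A.causal R R' T fun q hq => hR q (hq.trans hTt))
        have hpend : pending (followThenHome o T (A.run R)) Rhat R T =
            pending (followThenHome o T (A.run R')) Rhat R' T :=
          pending_congr (fun q s hs => hag.2 q s hs.le) fun q hq _ => hmem hTt q hq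
        have hposT : (followThenHome o T (A.run R)).pos T = (followThenHome o T (A.run R')).pos T :=
          hag.1 T hα le_rfl
        refine ⟨fun s hs0 hst => ?_, fun q s hs => ?_⟩
        · rcases le_total s T with hsT | hsT
          · rw [splice_pos hsT, splice_pos hsT, hag.1 s hs0 hsT]
          · rw [splice_pos_of_ge hX hsT, splice_pos_of_ge hX hsT, hpend, hposT]
        · rw [splice_pick_iff, splice_pick_iff, hpend, hposT]
          exact or_congr_left (and_congr_right fun hs => hag.2 q s hs.le)

theorem exists_isAlgoGen (hX : IsGeodesic X) (P : Problem) (hα : 0 ≤ α) (A : OnlineAlgorithm o ∅)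
    (Rhat : Finset (Request X)) : ∃ B : OnlineAlgorithm o Rhat, IsAlgoGen P α A Rhat B := by
  have hT : 0 ≤ α * opt o Rhat := mul_nonneg hα (opt_nonneg hX o Rhat)
  exact ⟨⟨frameworkRun A Rhat (α * opt o Rhat), fun R => (frameworkRun_spec hX hT A R).1,
    fun R R' t h => agreeUpTo_frameworkRun hX hT A R R' t h⟩,
    fun R _ => (frameworkRun_spec hX hT A R).2⟩

end Framework

/-! ### No algorithm is better than 2-competitive -/

section LowerBound

theorem isGeodesic_of_normedSpace (E : Type u) [NormedAddCommGroup E] [NormedSpace ℝ E] :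
    IsGeodesic E := by
  intro x y
  rcases eq_or_ne x y with rfl | hne
  · refine ⟨fun _ => x, rfl, rfl, fun s hs t ht => ?_⟩
    rw [dist_self] at hs ht
    rw [Set.Icc_self, Set.mem_singleton_iff] at hs ht
    simp [hs, ht]
  · have hd : 0 < dist x y := dist_pos.2 hne
    refine ⟨fun t => x + (t / dist x y) • (y - x), by simp, ?_, fun s _ t _ => ?_⟩
    · simp [div_self hd.ne']
    · rw [dist_add_left, dist_eq_norm, ← sub_smul, norm_smul, ← dist_eq_norm y x, dist_comm y x,
        ← sub_div, Real.norm_eq_abs, abs_div, abs_of_pos hd, div_mul_cancel₀ _ hd.ne']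

/-- Pigeonhole: a cell of length two, half-open, contains at most one of the times. -/
theorem exists_ge_of_separated {ι : Type*} [Fintype ι] [Nonempty ι] {n : ℝ} {s : ι → ℝ} (hs : ∀ i, n ≤ s i)
    (hsep : ∀ i j, i ≠ j → 2 ≤ |s i - s j|) : ∃ i, n + 2 * (Fintype.card ι - 1) ≤ s i := by
  by_contra! hlt
  have hpos : 1 ≤ Fintype.card ι := Fintype.card_pos
  have hmaps : ∀ i ∈ (Finset.univ : Finset ι),
      ⌊(s i - n) / 2⌋₊ ∈ Finset.range (Fintype.card ι - 1) := by
    intro i _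
    rw [Finset.mem_range, Nat.floor_lt (by linarith [hs i]), Nat.cast_sub hpos, Nat.cast_one]
    linarith [hlt i]
  obtain ⟨i, -, j, -, hij, he⟩ := Finset.exists_ne_map_eq_of_card_lt_of_maps_to
    (by rw [Finset.card_range, Finset.card_univ]; omega) hmaps
  have h1 := Nat.floor_le (show 0 ≤ (s i - n) / 2 by linarith [hs i])
  have h2 := Nat.lt_floor_add_one ((s i - n) / 2)
  have h3 := Nat.floor_le (show 0 ≤ (s j - n) / 2 by linarith [hs j])
  have h4 := Nat.lt_floor_add_one ((s j - n) / 2)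
  simp only [he] at h1 h2
  have := hsep i j hij
  have : |s i - s j| < 2 := by
    rw [abs_lt]; constructor <;> linarith
  linarith

variable {ι : Type u} [Fintype ι] [DecidableEq ι]

/-- Points of norm one at mutual distance two. -/
def leaf (i : ι) : ι → ℝ := fun j => if j = i then 1 else -1

theorem dist_leaf {i j : ι} (h : i ≠ j) : dist (leaf i) (leaf j) = 2 := by
  refine le_antisymm ((dist_pi_le_iff (by norm_num)).2 fun l => ?_) ?_
  · unfold leaf
    rw [Real.dist_eq]
    split_ifs <;> norm_num
  · have := dist_le_pi_dist (leaf i) (leaf j) i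
    simp only [leaf, if_true, h, if_false, Real.dist_eq] at this
    norm_num at this
    exact this

theorem dist_leaf_zero (i : ι) : dist (leaf i) 0 = 1 := by
  refine le_antisymm ((dist_pi_le_iff (by norm_num)).2 fun l => ?_) ?_
  · unfold leaf
    rw [Real.dist_eq]
    split_ifs <;> norm_num
  · have := dist_le_pi_dist (leaf i) 0 i
    simpa [leaf, Real.dist_eq] using this

theorem leaf_injective : Function.Injective (leaf : ι → ι → ℝ) := by
  intro i j h
  by_contra hne
  have := dist_leaf hne
  rw [h, dist_self] at this
  norm_num at this

/-- The request at leaf `i` with release date `2 * j`. -/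
def leafRequest (i : ι) (j : ℕ) : Request (ι → ℝ) := ⟨leaf i, leaf i, 2 * j, by positivity⟩

theorem leafRequest_len (i : ι) (j : ℕ) : (leafRequest i j).len = 0 := dist_self _

theorem exists_visited [Nonempty ι] {σ : Schedule (ι → ℝ)} {V : Set (Request (ι → ℝ))}
    (hσ : σ.Feasible 0 V) (j : ℕ) :
    ∃ w : ι, ∀ i s, 2 * (j : ℝ) ≤ s → s < 2 * (j + 1) → σ.pos s = leaf i → i = w := by
  by_cases h : ∃ w s, 2 * (j : ℝ) ≤ s ∧ s < 2 * (j + 1) ∧ σ.pos s = leaf w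
  · obtain ⟨w, s, h1, h2, h3⟩ := h
    refine ⟨w, fun i s' h1' h2' h3' => ?_⟩
    by_contra hne
    have hj : (0 : ℝ) ≤ j := j.cast_nonneg
    have hd := dist_leaf hne
    rcases le_total s s' with e | e
    · have := hσ.speed s s' (by linarith) e
      rw [h3, h3', dist_comm] at this
      linarith
    · have := hσ.speed s' s (by linarith) e
      rw [h3, h3'] at this
      linarith
  · exact ⟨Classical.arbitrary ι, fun i s h1 h2 h3 => absurd ⟨i, s, h1, h2, h3⟩ h⟩

variable [Nonempty ι]

/-- The leaf that is visited between the times `2 * j` and `2 * (j + 1)`. -/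
noncomputable def visited (A : OnlineAlgorithm (0 : ι → ℝ) ∅) (R : Finset (Request (ι → ℝ)))
    (j : ℕ) : ι := (exists_visited (A.feasible R) j).choose

open scoped Classical in
/-- The adversary releases a request at every leaf at time zero, and another one at a leaf when
the algorithm has visited it. -/
noncomputable def adversary (A : OnlineAlgorithm (0 : ι → ℝ) ∅) : ℕ → Finset (Request (ι → ℝ))
  | 0 => Finset.univ.image fun i => leafRequest i 0
  | j + 1 => insert (leafRequest (visited A (adversary A j) j) (j + 1)) (adversary A j)

variable (A : OnlineAlgorithm (0 : ι → ℝ) ∅)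

theorem mem_adversary {n : ℕ} {q : Request (ι → ℝ)} : q ∈ adversary A n ↔
    (∃ i, q = leafRequest i 0) ∨
      ∃ j < n, q = leafRequest (visited A (adversary A j) j) (j + 1) := by
  classical
  induction n with
  | zero => simp [adversary, eq_comm]
  | succ n ih =>
    rw [adversary, Finset.mem_insert, ih]
    constructor
    · rintro (h | h | ⟨j, hj, h⟩)
      · exact Or.inr ⟨n, n.lt_succ_self, h⟩
      · exact Or.inl h
      · exact Or.inr ⟨j, hj.trans n.lt_succ_self, h⟩
    · rintro (h | ⟨j, hj, h⟩)
      · exact Or.inr (Or.inl h)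
      · rcases (Nat.lt_succ_iff_lt_or_eq.1 hj) with hj | rfl
        · exact Or.inr (Or.inr ⟨j, hj, h⟩)
        · exact Or.inl h

/-- By causality, since requests added in round `j` or later are released at time `2 * (j + 1)` or
later. -/
theorem eq_visited {n j : ℕ} (hj : j < n) {i : ι} {s : ℝ} (h1 : 2 * (j : ℝ) ≤ s)
    (h2 : s < 2 * (j + 1)) (h3 : (A.run (adversary A n)).pos s = leaf i) :
    i = visited A (adversary A j) j := by
  have hs : 0 ≤ s := le_trans (by positivity) h1
  refine (exists_visited (A.feasible (adversary A j)) j).choose_spec i s h1 h2 ?_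
  rw [← h3]
  refine (A.causal _ _ s fun q hq => ?_).1 s hs le_rfl
  rw [mem_adversary, mem_adversary]
  refine or_congr_right ⟨fun ⟨m, hm, h⟩ => ⟨m, hm.trans hj, h⟩, fun ⟨m, hm, h⟩ => ⟨m, ?_, h⟩⟩
  by_contra! hle
  rw [h] at hq
  have : (2 : ℝ) * ((m + 1 : ℕ) : ℝ) ≤ s := hq
  push_cast at this
  have hc : (j : ℝ) ≤ m := by exact_mod_cast hle
  linarith

/-- The index of the last release date at leaf `i`. -/
noncomputable def lastRelease (n : ℕ) (i : ι) : ℕ :=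
  (Finset.range n).sup fun j => if visited A (adversary A j) j = i then j + 1 else 0

theorem le_lastRelease {n j : ℕ} (hj : j < n) :
    j + 1 ≤ lastRelease A n (visited A (adversary A j) j) := by
  have := Finset.le_sup (f := fun m => if visited A (adversary A m) m =
    visited A (adversary A j) j then m + 1 else 0) (Finset.mem_range.2 hj)
  simp only [if_true] at this
  exact this

theorem lastRelease_cases (n : ℕ) (i : ι) : lastRelease A n i = 0 ∨
    ∃ j < n, lastRelease A n i = j + 1 ∧ visited A (adversary A j) j = i := by
  rcases (Finset.range n).eq_empty_or_nonempty with h | h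
  · left
    simp [lastRelease, h]
  · obtain ⟨j, hj, he⟩ := Finset.exists_mem_eq_sup _ h
      fun j => if visited A (adversary A j) j = i then j + 1 else 0
    change lastRelease A n i = _ at he
    by_cases hv : visited A (adversary A j) j = i
    · rw [if_pos hv] at he
      exact Or.inr ⟨j, Finset.mem_range.1 hj, he, hv⟩
    · rw [if_neg hv] at he
      exact Or.inl he

theorem leafRequest_mem_adversary (n : ℕ) (i : ι) :
    leafRequest i (lastRelease A n i) ∈ adversary A n := by
  rw [mem_adversary]
  rcases lastRelease_cases A n i with h | ⟨j, hj, h1, h2⟩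
  · exact Or.inl ⟨i, by rw [h]⟩
  · exact Or.inr ⟨j, hj, by rw [h1, h2]⟩

theorem exists_eq_leafRequest {n : ℕ} {q : Request (ι → ℝ)} (hq : q ∈ adversary A n) :
    ∃ i j, q = leafRequest i j ∧ j ≤ lastRelease A n i := by
  rcases (mem_adversary A).1 hq with ⟨i, rfl⟩ | ⟨j, hj, rfl⟩
  · exact ⟨i, 0, rfl, Nat.zero_le _⟩
  · exact ⟨_, _, rfl, le_lastRelease A hj⟩

/-- Each round chooses one leaf, so nonzero last release dates are distinct. They extend to a
bijection of leaves with slots 1, ..., n, and visiting each leaf once, at twice its slot, serves all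
its requests. -/
theorem opt_adversary_le : opt 0 (adversary A (Fintype.card ι)) ≤ 2 * Fintype.card ι + 1 := by
  classical
  set n := Fintype.card ι with hn
  obtain ⟨g, hg⟩ := Finset.exists_equiv_extend_of_card_eq (α := ι) (t := Finset.Icc 1 n)
    (by simp [hn]) (s := Finset.univ.filter fun i => lastRelease A n i ≠ 0)
    (f := lastRelease A n) (by
      intro m hm
      obtain ⟨i, hi, rfl⟩ := Finset.mem_image.1 hm
      have hi := (Finset.mem_filter.1 hi).2
      rcases lastRelease_cases A n i with h | ⟨j, hj, h1, -⟩
      · exact absurd h hi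
      · rw [Finset.mem_Icc]; omega) (by
      intro i hi i' hi' he
      have hi := (Finset.mem_filter.1 (Finset.mem_coe.1 hi)).2
      have hi' := (Finset.mem_filter.1 (Finset.mem_coe.1 hi')).2
      rcases lastRelease_cases A n i with h | ⟨j, -, h1, h2⟩
      · exact absurd h hi
      rcases lastRelease_cases A n i' with h' | ⟨j', -, h1', h2'⟩
      · exact absurd h' hi'
      have : j = j' := by omega
      rw [← h2, ← h2', this])
  have hslot : ∀ i, 1 ≤ (g i : ℕ) ∧ (g i : ℕ) ≤ n := fun i => Finset.mem_Icc.1 (g i).2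
  have hlast : ∀ i, lastRelease A n i ≤ g i := by
    intro i
    by_cases h : lastRelease A n i = 0
    · omega
    · rw [hg i (Finset.mem_filter.2 ⟨Finset.mem_univ _, h⟩)]
  have hinv : ∀ i, Function.invFun (leaf : ι → ι → ℝ) (leaf i) = i :=
    Function.leftInverse_invFun leaf_injective
  obtain ⟨k, hk⟩ : ∃ k : Request (ι → ℝ) → ℝ, ∀ i j, k (leafRequest i j) = 2 * ((g i : ℕ) : ℝ) :=
    ⟨fun q => 2 * ((g (Function.invFun leaf q.src) : ℕ) : ℝ), fun i j => by
      change 2 * ((g (Function.invFun leaf (leaf i)) : ℕ) : ℝ) = _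
      rw [hinv]⟩
  refine opt_le (isGeodesic_of_normedSpace _) (k := k) ⟨?_, ?_, ?_, ?_, ?_⟩
  · rw [dist_self, add_zero]; positivity
  · intro q hq
    obtain ⟨i, j, rfl, -⟩ := exists_eq_leafRequest A (Finset.mem_coe.1 hq)
    rw [hk]
    have : (1 : ℝ) ≤ (g i : ℕ) := by exact_mod_cast (hslot i).1
    change 0 + dist 0 (leaf i) ≤ _
    rw [dist_comm, dist_leaf_zero]
    linarith
  · intro q hq
    obtain ⟨i, j, rfl, hj⟩ := exists_eq_leafRequest A (Finset.mem_coe.1 hq)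
    rw [hk]
    change 2 * (j : ℝ) ≤ _
    have : (j : ℝ) ≤ (g i : ℕ) := by exact_mod_cast hj.trans (hlast i)
    linarith
  · intro q hq
    obtain ⟨i, j, rfl, -⟩ := exists_eq_leafRequest A (Finset.mem_coe.1 hq)
    rw [hk, leafRequest_len]
    have : ((g i : ℕ) : ℝ) ≤ n := by exact_mod_cast (hslot i).2
    change _ + dist (leaf i) 0 ≤ _
    rw [dist_leaf_zero]
    linarith
  · intro q hq q' hq' _
    obtain ⟨i, j, rfl, -⟩ := exists_eq_leafRequest A (Finset.mem_coe.1 hq)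
    obtain ⟨i', j', rfl, -⟩ := exists_eq_leafRequest A (Finset.mem_coe.1 hq')
    rw [hk, hk, leafRequest_len, leafRequest_len]
    change _ + dist (leaf i) (leaf i') ≤ _ ∨ _ + dist (leaf i') (leaf i) ≤ _
    by_cases hii : i = i'
    · subst hii
      left; simp
    · rw [dist_leaf hii, dist_leaf (Ne.symm hii)]
      have hne : (g i : ℕ) ≠ g i' := fun h => hii (g.injective (Subtype.ext h))
      rcases lt_or_gt_of_ne hne with h | h
      · left
        have : ((g i : ℕ) : ℝ) + 1 ≤ (g i' : ℕ) := by exact_mod_cast h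
        linarith
      · right
        have : ((g i' : ℕ) : ℝ) + 1 ≤ (g i : ℕ) := by exact_mod_cast h
        linarith

/-- A visit before time 2n makes the adversary release another request at that leaf afterwards. So
the last requests of all n leaves are served from time 2n on, at times pairwise at least 2 apart. -/
theorem le_makespan_adversary : ENNReal.ofReal (4 * Fintype.card ι - 2) ≤
    (A.run (adversary A (Fintype.card ι))).makespan 0 (adversary A (Fintype.card ι)) := by
  refine le_iInf₂ fun t ht => ENNReal.ofReal_le_ofReal ?_
  set n := Fintype.card ι with hn
  have hf := A.feasible (adversary A n)
  choose s hs hst using fun i => ht.2.2 _ (leafRequest_mem_adversary A n i)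
  have hpos : ∀ i, (A.run (adversary A n)).pos (s i) = leaf i := fun i => hf.pick_up _ _ (hs i)
  have hs0 : ∀ i, 0 ≤ s i := fun i => hf.nonneg (hs i)
  have hrel : ∀ i, 2 * (lastRelease A n i : ℝ) ≤ s i := fun i => hf.release_le _ _ (hs i)
  have hge : ∀ i, 2 * (n : ℝ) ≤ s i := by
    intro i
    by_contra! hlt
    have h1 := Nat.floor_le (show 0 ≤ s i / 2 by linarith [hs0 i])
    have h2 := Nat.lt_floor_add_one (s i / 2)
    have h3 : ⌊s i / 2⌋₊ < n := by
      rw [Nat.floor_lt (by linarith [hs0 i])]; linarith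
    have h4 := eq_visited A h3 (i := i) (s := s i) (by linarith) (by linarith) (hpos i)
    have h5 := le_lastRelease A h3
    rw [← h4] at h5
    have h6 : ((⌊s i / 2⌋₊ : ℕ) : ℝ) + 1 ≤ lastRelease A n i := by exact_mod_cast h5
    linarith [hrel i]
  obtain ⟨i, hi⟩ := exists_ge_of_separated hge fun i j hij => by
    have hd := dist_leaf hij
    rw [← hpos i, ← hpos j] at hd
    rcases le_total (s i) (s j) with e | e
    · have := hf.speed _ _ (hs0 i) e
      rw [abs_sub_comm, abs_of_nonneg (by linarith)]
      linarith
    · have := hf.speed _ _ (hs0 j) e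
      rw [dist_comm] at this
      rw [abs_of_nonneg (by linarith)]
      linarith
  have := hst i
  rw [leafRequest_len] at this
  rw [← hn] at hi
  linarith

/-- No online algorithm is better than 2-competitive in all geodesic spaces. -/
theorem two_le_of_isCompetitive (P : Problem) (ρ : ℝ)
    (A : ∀ M : ServerSpace.{u}, OnlineAlgorithm M.origin ∅)
    (hA : ∀ M : ServerSpace.{u}, (A M).IsCompetitive P ρ) : 2 ≤ ρ := by
  by_contra! hρ
  -- The adversary forces 4n - 2 ≤ ρ(2n + 1), that is 2n(2 - ρ) ≤ 2 + ρ < 4.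
  obtain ⟨n, hn⟩ := exists_nat_gt (2 / (2 - ρ))
  rw [div_lt_iff₀ (by linarith)] at hn
  have hn0 : (1 : ℝ) ≤ n := by
    rcases Nat.eq_zero_or_pos n with rfl | h
    · norm_num at hn
    · exact_mod_cast h
  have : NeZero n := ⟨by rintro rfl; norm_num at hn0⟩
  let M : ServerSpace.{u} := ⟨ULift.{u} (Fin n) → ℝ, 0, isGeodesic_of_normedSpace _⟩
  let A' : OnlineAlgorithm (0 : ULift.{u} (Fin n) → ℝ) ∅ := A M
  have hcard : Fintype.card (ULift.{u} (Fin n)) = n := by simp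
  have hadm : P.Admits (adversary A' (Fintype.card (ULift.{u} (Fin n)))) := by
    cases P with
    | OlDARP => trivial
    | OlTSP =>
      intro q hq
      obtain ⟨i, j, rfl, -⟩ := exists_eq_leafRequest A' hq
      rfl
  have hle := (le_makespan_adversary A').trans (hA M _ hadm)
  have hopt := opt_adversary_le A'
  have hopt0 := opt_nonneg (isGeodesic_of_normedSpace _) 0
    (adversary A' (Fintype.card (ULift.{u} (Fin n))))
  set C := opt 0 (adversary A' (Fintype.card (ULift.{u} (Fin n)))) with hC
  rw [hcard] at hle hopt
  rcases ENNReal.ofReal_le_ofReal_iff'.1 hle with h | h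
  · change _ ≤ ρ * C at h
    nlinarith
  · linarith

end LowerBound

end OnlineRouting

theorem theorem1 (P : Problem) (ρ : ℝ)
    (A : ∀ M : ServerSpace.{u}, OnlineAlgorithm M.origin ∅)
    (hA : ∀ M : ServerSpace.{u}, (A M).IsCompetitive P ρ)
    (α : ℝ) (hα : 0 < α) (M : ServerSpace.{u})
    (Rhat : Finset (Request M.Point)) (hRhat : P.Admits Rhat) :
    (∃ B : OnlineAlgorithm M.origin Rhat, IsAlgoGen P α (A M) Rhat B) ∧
    ∀ B : OnlineAlgorithm M.origin Rhat, IsAlgoGen P α (A M) Rhat B →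
      ∀ R : Finset (Request M.Point), P.Admits R →
        (B.run R).makespan M.origin R ≤
          ENNReal.ofReal (1 + α) *
            (ENNReal.ofReal (opt M.origin R) + 3 * coverError P 1 R Rhat) ∧
        (B.run R).makespan M.origin R ≤
          ENNReal.ofReal ((1 + ρ + ρ / α) * opt M.origin R) := by
  have hX : IsGeodesic M.Point := M.geodesic
  -- Only this step uses competitiveness in spaces other than `M`.
  have hρ := two_le_of_isCompetitive P ρ A hA
  refine ⟨exists_isAlgoGen hX P hα.le (A M) Rhat, fun B hB R hR => ⟨?_, ?_⟩⟩
  · refine ((hB R hR).consistent hX hα (B.feasible R)).trans ?_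
    gcongr
    exact coverError_olDARP_le hX hR
  · exact (hB R hR).robust hX hα hρ ((A M).feasible R) (B.feasible R) (hA M R hR)
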